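/- For $\alpha\in[0,\infty)$ and $\gamma\in(0,\infty]$, not both $\alpha=0$ and $\gamma=\infty$, let $$f_{\alpha,\gamma}(x)=\frac{1}{2(\alpha+1/\gamma)}\exp\{-\gamma(|x|-\alpha)_+\},\qquad x\in\mathbb{R},$$ where $\gamma=\infty$ is understood to give the uniform density $\frac1{2\alpha}\mathbf 1_{\{|x|\le\alpha\}}$. For $\alpha\in(0,\infty]$ and $\gamma\in[0,\infty)$, not both $\alpha=\infty$ and $\gamma=0$, let $$g_{\alpha,\gamma}(x)=\frac{\gamma}{2(1-e^{-\alpha\gamma})}e^{-\gamma|x|}\mathbf 1_{\{|x|\le\alpha\}},\qquad x\in\mathbb{R},$$ where $\gamma=0$ is understood to give the uniform density $\frac1{2\alpha}\mathbf 1_{\{|x|\le\alpha\}}$ and $\alpha=\infty$ the two-sided exponential density $\frac\gamma2e^{-\gamma|x|}$. Let $\mathcal F^-$ be the set of all the functions $f_{\alpha,\gamma}$ and $\mathcal F^+$ the set of all the functions $g_{\alpha,\gamma}$. Let $p>2$. For all $a,b>0$ such that $$3^{1/2}(p+1)^{-1/p}\le\frac ba\le 2^{-1/2}\,\Gamma(p+1)^{1/p},\qquad(*)$$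 there exist a unique $f^-\in\mathcal F^-$ and a unique $f^+\in\mathcal F^+$ with $$\int_{\mathbb R}x^2f^\pm(x)\,dx=a^2\quad\text{and}\quad\int_{\mathbb R}|x|^pf^\pm(x)\,dx=b^p.$$ Conversely, let $X$ be a symmetric real random variable that is log-concave, i.e. has a density of the form $e^{-\phi}$ with $\phi\colon\mathbb R\to(-\infty,+\infty]$ convex. Then $\mathbb EX^2$ and $\mathbb E|X|^p$ are finite and positive, and $a=(\mathbb EX^2)^{1/2}$, $b=(\mathbb E|X|^p)^{1/p}$ satisfy $(*)$. -/

import Mathlib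

open MeasureTheory ProbabilityTheory Set
open scoped NNReal ENNReal

noncomputable section

/-- The uniform density on `[-α, α]`. -/
def uniformDensity (α : ℝ) : ℝ → ℝ :=
  (Icc (-α) α).indicator fun _ => 1 / (2 * α)

/-- The two-sided exponential density `(γ / 2) exp (-γ |x|)`. -/
def twoSidedExpDensity (γ : ℝ) (x : ℝ) : ℝ :=
  γ / 2 * Real.exp (-γ * |x|)

/-- `f_{α,γ}` for `α ∈ [0, ∞)` and `γ ∈ (0, ∞]`; `γ = ∞` gives the uniform density on `[-α, α]`.
For `α = 0`, `γ < ∞` the formula gives the two-sided exponential density. -/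
def fDensity (α : ℝ≥0) (γ : ℝ≥0∞) (x : ℝ) : ℝ :=
  if γ = ∞ then uniformDensity α x
  else 1 / (2 * ((α : ℝ) + 1 / γ.toReal)) * Real.exp (-γ.toReal * max (|x| - (α : ℝ)) 0)

/-- `g_{α,γ}` for `α ∈ (0, ∞]` and `γ ∈ [0, ∞)`; `γ = 0` gives the uniform density on `[-α, α]`
and `α = ∞` the two-sided exponential density. -/
def gDensity (α : ℝ≥0∞) (γ : ℝ≥0) (x : ℝ) : ℝ :=
  if γ = 0 then uniformDensity α.toReal x
  else if α = ∞ then twoSidedExpDensity γ x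
  else (γ : ℝ) / (2 * (1 - Real.exp (-(α.toReal * (γ : ℝ))))) *
    {y : ℝ | |y| ≤ α.toReal}.indicator (fun y => Real.exp (-(γ : ℝ) * |y|)) x

/-- The family of the densities `f_{α,γ}`. The pair `(0, ∞)` defines no density and is left out. -/
def familyMinus : Set (ℝ → ℝ) :=
  {f | ∃ (α : ℝ≥0) (γ : ℝ≥0∞), 0 < γ ∧ ¬ (α = 0 ∧ γ = ∞) ∧ f = fDensity α γ}

/-- The family of the densities `g_{α,γ}`. The pair `(∞, 0)` defines no density and is left out. -/
def familyPlus : Set (ℝ → ℝ) :=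
  {g | ∃ (α : ℝ≥0∞) (γ : ℝ≥0), 0 < α ∧ ¬ (α = ∞ ∧ γ = 0) ∧ g = gDensity α γ}

/-- The function `f` has second moment `a ^ 2` and absolute `p`-th moment `b ^ p`. -/
def HasMoments (p a b : ℝ) (f : ℝ → ℝ) : Prop :=
  (Integrable (fun x : ℝ => x ^ 2 * f x) ∧ ∫ x : ℝ, x ^ 2 * f x = a ^ 2) ∧
  (Integrable (fun x : ℝ => |x| ^ p * f x) ∧ ∫ x : ℝ, |x| ^ p * f x = b ^ p)

/-- The two-sided bound on the ratio `b / a`. -/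
def Feasible (p a b : ℝ) : Prop :=
  (3 : ℝ) ^ (1 / 2 : ℝ) * (p + 1) ^ (-1 / p) ≤ b / a ∧
  b / a ≤ (2 : ℝ) ^ (-1 / 2 : ℝ) * Real.Gamma (p + 1) ^ (1 / p)

/-- `φ : ℝ → (-∞, +∞]` is convex. -/
def IsConvexPotential (φ : ℝ → EReal) : Prop :=
  (∀ x, φ x ≠ ⊥) ∧
  ∀ x y s t : ℝ, 0 < s → 0 < t → s + t = 1 →
    φ (s * x + t * y) ≤ (s : EReal) * φ x + (t : EReal) * φ y

/-- The random variable `X` has a density `exp (-φ)` with `φ : ℝ → (-∞, +∞]` convex. -/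
def IsLogConcaveVar {Ω : Type*} [MeasurableSpace Ω] (X : Ω → ℝ) (P : Measure Ω) : Prop :=
  AEMeasurable X P ∧ ∃ φ : ℝ → EReal, IsConvexPotential φ ∧
    P.map X = volume.withDensity fun x => EReal.exp (-φ x)

/-- The random variable `X` is symmetric: `-X` has the same law as `X`. -/
def IsSymmetricVar {Ω : Type*} [MeasurableSpace Ω] (X : Ω → ℝ) (P : Measure Ω) : Prop :=
  IdentDistrib (fun ω => -X ω) X P P

end

open scoped Topology

/-! Everything rests on one sign-change principle, `integral_nonneg_of_ordConnected_neg`. Let w be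
even with vanishing mass and second moment, and negative on (0, ∞) exactly on an interval with ends
s < t. In the variable y = x², the function y ^ (p / 2) is strictly convex, so subtracting its chord
A + B * y through s² and t² gives a factor with the same sign as w. The subtracted terms integrate
to zero against w, hence the p-th moment of w is nonnegative, and it vanishes only if w = 0 a.e.

Applied to w = f - g (`absMoment_le_of_ordConnected`), this orders the p-th moments of two even
densities with equal second moments as soon as {f < g} is an interval on the positive axis. Two
members of the same family always have this property in one order or the other, so equal moments
make them equal a.e., and one-sided continuity makes them equal everywhere. For an even log-concave
density h, both {h < uniform} and {exponential < h} are intervals, so the uniform and two-sided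
exponential densities are extremal; their moment ratios are the two sides of (*).

For existence, each family is, up to dilation, a one-parameter curve joining the uniform density to
the exponential one. The ratio of the p-th moment to the power p / 2 of the second moment does not
change under dilation and is continuous along the curve. The intermediate value theorem selects the
shape, and a dilation then fixes the second moment. -/

/-! ### Sign changes and moments. -/

/-- A strictly convex function lies below a chord between its endpoints and above it outside. -/
theorem StrictConvexOn.exists_chord {f : ℝ → ℝ} (hf : StrictConvexOn ℝ (Ici 0) f) {S T : ℝ}
    (hS : 0 ≤ S) (hST : S < T) :
    ∃ A B : ℝ, (∀ y, 0 ≤ y → y < S ∨ T < y → A + B * y < f y) ∧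
      ∀ y ∈ Ioo S T, f y < A + B * y := by
  have hd : 0 < T - S := by linarith
  refine ⟨f S - (f T - f S) / (T - S) * S, (f T - f S) / (T - S), ?_, ?_⟩
  · rintro y hy (h | h)
    · have := hf.slope_strict_mono_adjacent (mem_Ici.2 hy) (mem_Ici.2 (hS.trans hST.le)) h hST
      rw [div_lt_iff₀ (by linarith)] at this
      linarith
    · have := hf.slope_strict_mono_adjacent (mem_Ici.2 hS) (mem_Ici.2 hy) hST h
      rw [lt_div_iff₀ (by linarith)] at this
      have e : (f T - f S) / (T - S) * (T - S) = f T - f S := div_mul_cancel₀ _ hd.ne'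
      linarith
  · rintro y ⟨h1, h2⟩
    have := hf.secant_strict_mono (mem_Ici.2 hS) (mem_Ici.2 (hS.trans h1.le))
      (mem_Ici.2 (hS.trans hST.le)) h1.ne' hST.ne' h2
    rw [div_lt_iff₀ (by linarith)] at this
    linarith

theorem ae_eq_zero_of_integral_mul_eq_zero {w D : ℝ → ℝ} (hD : ∀ᵐ x, D x ≠ 0)
    (h0 : ∀ᵐ x, 0 ≤ D x * w x) (hi : Integrable fun x => D x * w x)
    (hz : ∫ x, D x * w x = 0) : w =ᵐ[volume] 0 := by
  have := (integral_eq_zero_iff_of_nonneg_ae h0 hi).1 hz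
  filter_upwards [this, hD] with x hx hx'
  simpa [hx'] using hx

theorem ae_abs_ne (s : ℝ) : ∀ᵐ x : ℝ, |x| ≠ s := by
  have h1 : ∀ᵐ x : ℝ, x ≠ s := by simp [ae_iff]
  have h2 : ∀ᵐ x : ℝ, x ≠ -s := by simp [ae_iff]
  filter_upwards [h1, h2] with x a b h
  rcases abs_choice x with h' | h'
  · exact a (h' ▸ h)
  · exact b (by linarith)

/-- Multiplying w by |x| ^ p - A - B * x ^ 2, with the chord taken at the ends of the negativity
interval, gives a nonnegative integrand with the same integral as |x| ^ p * w. The factor is nonzero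
a.e., which settles the equality case. Degenerate intervals force w = 0 a.e. outright. -/
theorem integral_nonneg_of_ordConnected_neg {p : ℝ} (hp : 2 < p) {w : ℝ → ℝ}
    (heven : ∀ x, w |x| = w x)
    (hi0 : Integrable w) (hi2 : Integrable fun x => x ^ 2 * w x)
    (hip : Integrable fun x => |x| ^ p * w x)
    (h0 : ∫ x, w x = 0) (h2 : ∫ x, x ^ 2 * w x = 0)
    (hN : {x | 0 < x ∧ w x < 0}.OrdConnected) :
    0 ≤ ∫ x, |x| ^ p * w x ∧ (∫ x, |x| ^ p * w x = 0 → w =ᵐ[volume] 0) := by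
  suffices H : w =ᵐ[volume] 0 ∨
      (0 ≤ ∫ x, |x| ^ p * w x ∧ (∫ x, |x| ^ p * w x = 0 → w =ᵐ[volume] 0)) by
    rcases H with H | H
    · refine ⟨?_, fun _ => H⟩
      rw [integral_eq_zero_of_ae]
      filter_upwards [H] with x hx
      simp [hx]
    · exact H
  set N : Set ℝ := {x | 0 < x ∧ w x < 0} with hNdef
  have hpos : ∀ x, 0 < |x| → |x| ∉ N → 0 ≤ w x := by
    intro x hx hn
    by_contra! h
    exact hn ⟨hx, by rwa [heven]⟩
  have key : (∀ᵐ x, 0 ≤ w x) → w =ᵐ[volume] 0 := fun h =>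
    (integral_eq_zero_iff_of_nonneg_ae h hi0).1 h0
  rcases N.eq_empty_or_nonempty with hE | hNe
  · left
    apply key
    filter_upwards [ae_abs_ne 0] with x hx
    exact hpos x (lt_of_le_of_ne (abs_nonneg x) hx.symm) (by simp [hE])
  have hbb : BddBelow N := ⟨0, fun x hx => hx.1.le⟩
  have hs0 : 0 ≤ sInf N := le_csInf hNe fun x hx => hx.1.le
  by_cases hba : BddAbove N
  swap
  -- If w is negative on the whole ray beyond s, there is a single sign change, and s ^ 2 - x ^ 2
  -- already matches the sign of w. Its integral against w is zero, so w = 0 a.e.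
  · left
    set s := sInf N
    have hneg : ∀ x, s < x → w x < 0 := by
      intro x hx
      obtain ⟨y, hy, hyx⟩ := exists_lt_of_csInf_lt hNe hx
      obtain ⟨z, hz, hxz⟩ := not_bddAbove_iff.1 hba x
      exact (hN.out hy hz ⟨hyx.le, hxz.le⟩).2
    have e : ∀ x, (s ^ 2 - x ^ 2) * w x = s ^ 2 * w x - x ^ 2 * w x := fun x => by ring
    refine ae_eq_zero_of_integral_mul_eq_zero (D := fun x => s ^ 2 - x ^ 2) ?_ ?_ ?_ ?_
    · filter_upwards [ae_abs_ne s] with x hx h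
      exact hx ((sq_eq_sq₀ (abs_nonneg x) hs0).1 (by rw [sq_abs]; linarith))
    · filter_upwards [ae_abs_ne s, ae_abs_ne 0] with x hx hx0
      rcases lt_or_gt_of_ne hx with h | h
      · refine mul_nonneg ?_ (hpos x (lt_of_le_of_ne (abs_nonneg x) hx0.symm)
          fun hm => (csInf_le hbb hm).not_gt h)
        have := pow_le_pow_left₀ (abs_nonneg x) h.le 2
        rw [sq_abs] at this
        linarith
      · refine mul_nonneg_of_nonpos_of_nonpos ?_ (by rw [← heven]; exact (hneg _ h).le)
        have := pow_le_pow_left₀ hs0 h.le 2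
        rw [sq_abs] at this
        linarith
    · simp_rw [e]; exact (hi0.const_mul _).sub hi2
    · simp_rw [e]
      rw [integral_sub (hi0.const_mul _) hi2, integral_const_mul, h0, h2]; simp
  · set s := sInf N
    set t := sSup N
    have hst : s ≤ t := csInf_le_csSup hNe hbb hba
    -- When s = t, negativity occurs at most at |x| = s, so w is a.e. nonnegative with zero
    -- integral.
    rcases hst.eq_or_lt with hst | hst
    · left
      apply key
      filter_upwards [ae_abs_ne 0, ae_abs_ne s] with x hx hxs
      refine hpos x (lt_of_le_of_ne (abs_nonneg x) hx.symm) fun hm => hxs ?_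
      exact le_antisymm ((le_csSup hba hm).trans hst.ge) (csInf_le hbb hm)
    right
    have hneg : ∀ x, s < x → x < t → w x < 0 := by
      intro x hx hxt
      obtain ⟨y, hy, hyx⟩ := exists_lt_of_csInf_lt hNe hx
      obtain ⟨z, hz, hxz⟩ := exists_lt_of_lt_csSup hNe hxt
      exact (hN.out hy hz ⟨hyx.le, hxz.le⟩).2
    have hsq : ∀ {x y : ℝ}, 0 ≤ x → x < y → x ^ 2 < y ^ 2 :=
      fun hx hxy => pow_lt_pow_left₀ hxy hx two_ne_zero
    obtain ⟨A, B, hout, hin⟩ := (strictConvexOn_rpow (p := p / 2) (by linarith)).exists_chord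
      (sq_nonneg s) (hsq hs0 hst)
    have hpw : ∀ x : ℝ, (|x| ^ 2) ^ (p / 2) = |x| ^ p := fun x => by
      rw [← Real.rpow_natCast, ← Real.rpow_mul (abs_nonneg x)]
      congr 1
      push_cast
      ring
    have hout' : ∀ x : ℝ, |x| < s ∨ t < |x| → 0 < |x| ^ p - A - B * x ^ 2 := by
      intro x hx
      have := hout (|x| ^ 2) (sq_nonneg _)
        (hx.imp (hsq (abs_nonneg x)) (hsq (hs0.trans hst.le)))
      rw [hpw, sq_abs] at this
      linarith
    have hin' : ∀ x : ℝ, s < |x| → |x| < t → |x| ^ p - A - B * x ^ 2 < 0 := by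
      intro x h1 h2
      have := hin (|x| ^ 2) ⟨hsq hs0 h1, hsq (abs_nonneg x) h2⟩
      rw [hpw, sq_abs] at this
      linarith
    have e : ∀ x, (|x| ^ p - A - B * x ^ 2) * w x
        = |x| ^ p * w x - A * w x - B * (x ^ 2 * w x) := fun x => by ring
    have hsub : Integrable fun x => |x| ^ p * w x - A * w x := hip.sub (hi0.const_mul _)
    have hI : ∫ x, (|x| ^ p - A - B * x ^ 2) * w x = ∫ x, |x| ^ p * w x := by
      simp_rw [e]
      rw [integral_sub hsub (hi2.const_mul _),
        integral_sub hip (hi0.const_mul _), integral_const_mul, integral_const_mul, h0, h2]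
      simp
    have hnn : ∀ᵐ x, 0 ≤ (|x| ^ p - A - B * x ^ 2) * w x := by
      filter_upwards [ae_abs_ne s, ae_abs_ne t, ae_abs_ne 0] with x hxs hxt hx0
      have hx0 : 0 < |x| := lt_of_le_of_ne (abs_nonneg x) hx0.symm
      rcases lt_or_gt_of_ne hxs with h | h
      · exact mul_nonneg (hout' x (.inl h)).le (hpos x hx0 fun hm => (csInf_le hbb hm).not_gt h)
      rcases lt_or_gt_of_ne hxt with h' | h'
      · exact mul_nonneg_of_nonpos_of_nonpos (hin' x h h').le
          (by rw [← heven]; exact (hneg _ h h').le)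
      · exact mul_nonneg (hout' x (.inr h')).le (hpos x hx0 fun hm => (le_csSup hba hm).not_gt h')
    refine ⟨hI ▸ integral_nonneg_of_ae hnn, fun hz => ?_⟩
    refine ae_eq_zero_of_integral_mul_eq_zero (D := fun x => |x| ^ p - A - B * x ^ 2)
      ?_ hnn ?_ (hI.trans hz)
    · filter_upwards [ae_abs_ne s, ae_abs_ne t] with x hxs hxt
      rcases lt_or_gt_of_ne hxs with h | h
      · exact (hout' x (.inl h)).ne'
      rcases lt_or_gt_of_ne hxt with h' | h'
      · exact (hin' x h h').ne
      · exact (hout' x (.inr h')).ne'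
    · simp_rw [e]; exact hsub.sub (hi2.const_mul _)

/-! ### Absolute moments and dilations. -/

/-- The absolute moment of order `q` of the density `f` exists and equals `m`. -/
def HasAbsMoment (q m : ℝ) (f : ℝ → ℝ) : Prop :=
  Integrable (fun x : ℝ => |x| ^ q * f x) ∧ ∫ x : ℝ, |x| ^ q * f x = m

theorem hasMoments_iff {p a b : ℝ} {f : ℝ → ℝ} :
    HasMoments p a b f ↔ HasAbsMoment 2 (a ^ 2) f ∧ HasAbsMoment p (b ^ p) f := by
  simp [HasMoments, HasAbsMoment]

theorem HasAbsMoment.of_half {q m : ℝ} {f : ℝ → ℝ} (hm : m ≠ 0) (heven : ∀ x, f |x| = f x)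
    (h : 2 * ∫ x in Ioi (0 : ℝ), x ^ q * f x = m) : HasAbsMoment q m f := by
  have : ∫ x : ℝ, |x| ^ q * f x = m := by
    rw [← h, ← integral_comp_abs (f := fun x => x ^ q * f x)]
    simp_rw [heven]
  -- The Bochner integral of a non-integrable function is 0, so a nonzero value yields
  -- integrability.
  exact ⟨.of_integral_ne_zero (this ▸ hm), this⟩

/-- Dilation of a density by the factor `l`. -/
noncomputable def dilate (l : ℝ) (f : ℝ → ℝ) (x : ℝ) : ℝ := l⁻¹ * f (l⁻¹ * x)

theorem HasAbsMoment.dilate {q m l : ℝ} {f : ℝ → ℝ} (hl : 0 < l) (h : HasAbsMoment q m f) :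
    HasAbsMoment q (l ^ q * m) (dilate l f) := by
  have e : (fun x : ℝ => |x| ^ q * _root_.dilate l f x)
      = fun x => l⁻¹ * l ^ q * (|l⁻¹ * x| ^ q * f (l⁻¹ * x)) := by
    ext x
    rw [_root_.dilate, abs_mul, abs_of_pos (inv_pos.2 hl),
      Real.mul_rpow (inv_pos.2 hl).le (abs_nonneg x), Real.inv_rpow hl.le]
    have := (Real.rpow_pos_of_pos hl q).ne'
    field_simp
  refine ⟨?_, ?_⟩
  · rw [e]
    exact (h.1.comp_mul_left' (inv_pos.2 hl).ne').const_mul _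
  · rw [e, integral_const_mul, Measure.integral_comp_mul_left (fun x => |x| ^ q * f x), h.2,
      inv_inv, abs_of_pos hl, smul_eq_mul]
    field_simp

/-! ### Moments of flat densities with exponential tails. -/

theorem setIntegral_Ioi_comp_add_left (g : ℝ → ℝ) (c : ℝ) :
    ∫ x in Ioi c, g x = ∫ x in Ioi (0 : ℝ), g (c + x) := by
  have := (measurePreserving_add_left (volume : Measure ℝ) c).setIntegral_preimage_emb
    (measurableEmbedding_addLeft c) g (Ioi c)
  rw [← this]
  simp

theorem setIntegral_Ioi_comp_add_mul (g : ℝ → ℝ) (c : ℝ) {s : ℝ} (hs : 0 < s) :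
    ∫ x in Ioi c, g x = s * ∫ x in Ioi (0 : ℝ), g (c + s * x) := by
  rw [setIntegral_Ioi_comp_add_left, integral_comp_mul_left_Ioi (fun y => g (c + y)) 0 hs]
  simp [hs.ne']

/-- Supplies the dominating function, uniform in s, for the tail integrals in `plateauMoment`. It
follows from (1 + v) ^ q ≤ 2 ^ q * (1 + v ^ q) and convergence of the Gamma integral. -/
theorem integrableOn_one_add_rpow_mul_exp_neg {q : ℝ} (hq : 0 ≤ q) :
    IntegrableOn (fun v : ℝ => (1 + v) ^ q * Real.exp (-v)) (Ioi 0) := by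
  have h : IntegrableOn (fun v : ℝ => 2 ^ q * (Real.exp (-v) * v ^ ((0 + 1 : ℝ) - 1)
      + Real.exp (-v) * v ^ ((q + 1) - 1))) (Ioi 0) :=
    ((Real.GammaIntegral_convergent (by norm_num)).add
      (Real.GammaIntegral_convergent (by linarith))).const_mul _
  refine Integrable.mono' h ?_ ?_
  · refine (Measurable.aestronglyMeasurable ?_)
    fun_prop
  · filter_upwards [self_mem_ae_restrict measurableSet_Ioi] with v hv
    have hv : 0 < v := hv
    rw [Real.norm_of_nonneg (by positivity)]
    have hb : (1 + v) ^ q ≤ 2 ^ q * (1 + v ^ q) := by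
      rcases le_total v 1 with h1 | h1
      · calc (1 + v) ^ q ≤ 2 ^ q := Real.rpow_le_rpow (by linarith) (by linarith) hq
          _ ≤ 2 ^ q * (1 + v ^ q) := le_mul_of_one_le_right (by positivity)
            (by linarith [Real.rpow_nonneg hv.le q])
      · calc (1 + v) ^ q ≤ (2 * v) ^ q := Real.rpow_le_rpow (by linarith) (by linarith) hq
          _ = 2 ^ q * v ^ q := Real.mul_rpow (by norm_num) hv.le
          _ ≤ 2 ^ q * (1 + v ^ q) := by gcongr; linarith
    calc (1 + v) ^ q * Real.exp (-v) ≤ 2 ^ q * (1 + v ^ q) * Real.exp (-v) := by gcongr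
      _ = _ := by simp; ring

theorem one_sub_add_mul_bounds {s v : ℝ} (hs : s ∈ Icc (0 : ℝ) 1) (hv : 0 < v) :
    0 ≤ 1 - s + s * v ∧ 1 - s + s * v ≤ 1 + v := by
  obtain ⟨h0, h1⟩ := hs
  refine ⟨by nlinarith, by nlinarith⟩

theorem integrableOn_one_sub_add_mul_rpow {q s : ℝ} (hq : 0 ≤ q) (hs : s ∈ Icc (0 : ℝ) 1) :
    IntegrableOn (fun v : ℝ => (1 - s + s * v) ^ q * Real.exp (-v)) (Ioi 0) := by
  refine Integrable.mono' (integrableOn_one_add_rpow_mul_exp_neg hq) ?_ ?_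
  · refine (Measurable.aestronglyMeasurable ?_)
    fun_prop
  · filter_upwards [self_mem_ae_restrict measurableSet_Ioi] with v hv
    obtain ⟨h0, h1⟩ := one_sub_add_mul_bounds hs hv
    rw [Real.norm_of_nonneg (by positivity)]
    gcongr

/-- The absolute moment of order `q` of the density that is constant on `[-(1 - s), 1 - s]` and has
exponential tails of scale `s`. -/
noncomputable def plateauMoment (q s : ℝ) : ℝ :=
  (1 - s) ^ (q + 1) / (q + 1) + s * ∫ v in Ioi (0 : ℝ), (1 - s + s * v) ^ q * Real.exp (-v)

theorem plateauMoment_zero {q : ℝ} : plateauMoment q 0 = 1 / (q + 1) := by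
  simp [plateauMoment]

theorem plateauMoment_one {q : ℝ} (hq : 0 ≤ q) : plateauMoment q 1 = Real.Gamma (q + 1) := by
  rw [Real.Gamma_eq_integral (by linarith)]
  simp [plateauMoment, Real.zero_rpow (by linarith : q + 1 ≠ 0), mul_comm]

theorem plateauMoment_order_zero (s : ℝ) : plateauMoment 0 s = 1 := by
  simp [plateauMoment, integral_exp_Iic_zero]

theorem plateauMoment_pos {q s : ℝ} (hq : 0 ≤ q) (hs : s ∈ Icc (0 : ℝ) 1) :
    0 < plateauMoment q s := by
  rcases hs.2.eq_or_lt with rfl | h1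
  · rw [plateauMoment_one hq]
    exact Real.Gamma_pos_of_pos (by linarith)
  · have h : 0 < 1 - s := by linarith
    refine add_pos_of_pos_of_nonneg (by positivity) (mul_nonneg hs.1 ?_)
    refine setIntegral_nonneg measurableSet_Ioi fun v hv => ?_
    have := (one_sub_add_mul_bounds hs hv).1
    positivity

theorem continuousOn_plateauMoment {q : ℝ} (hq : 0 ≤ q) :
    ContinuousOn (plateauMoment q) (Icc 0 1) := by
  refine ContinuousOn.add ?_ (continuousOn_id.mul ?_)
  · have : Continuous fun s : ℝ => (1 - s) ^ (q + 1) :=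
      (Real.continuous_rpow_const (by linarith)).comp (continuous_const.sub continuous_id)
    exact (this.div_const _).continuousOn
  · refine continuousOn_of_dominated (bound := fun v => (1 + v) ^ q * Real.exp (-v)) ?_ ?_
      (integrableOn_one_add_rpow_mul_exp_neg hq) ?_
    · exact fun s hs => (integrableOn_one_sub_add_mul_rpow hq hs).1
    · intro s hs
      filter_upwards [self_mem_ae_restrict measurableSet_Ioi] with v hv
      obtain ⟨h0, h1⟩ := one_sub_add_mul_bounds hs hv
      rw [Real.norm_of_nonneg (by positivity)]
      gcongr
    · refine Filter.Eventually.of_forall fun v => Continuous.continuousOn ?_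
      exact ((Real.continuous_rpow_const hq).comp (by fun_prop)).mul continuous_const

/-- The density that is constant on `[-(1 - s), 1 - s]` with exponential tails of scale `s`. -/
noncomputable def plateauDensity (s x : ℝ) : ℝ :=
  if s = 0 then (if |x| ≤ 1 then 1 / 2 else 0)
  else 1 / 2 * Real.exp (-(s⁻¹ * max (|x| - (1 - s)) 0))

theorem setIntegral_Ioi_ite_le {c : ℝ} (hc : 0 ≤ c) (g : ℝ → ℝ) :
    ∫ x in Ioi (0 : ℝ), (if x ≤ c then g x else 0) = ∫ x in (0 : ℝ)..c, g x := by
  rw [intervalIntegral.integral_of_le hc, ← Ioi_inter_Iic,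
    ← setIntegral_indicator measurableSet_Iic]
  rfl

theorem hasAbsMoment_plateauDensity {q s : ℝ} (hq : 0 ≤ q) (hs : s ∈ Icc (0 : ℝ) 1) :
    HasAbsMoment q (plateauMoment q s) (plateauDensity s) := by
  refine .of_half (plateauMoment_pos hq hs).ne' (fun x => by simp [plateauDensity]) ?_
  rcases hs.1.eq_or_lt with rfl | h0
  · have : ∀ x ∈ Ioi (0 : ℝ), x ^ q * plateauDensity 0 x = if x ≤ 1 then x ^ q * (1 / 2) else 0 := by
      intro x hx
      rw [plateauDensity, abs_of_pos hx]
      simp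
    rw [setIntegral_congr_fun measurableSet_Ioi this, setIntegral_Ioi_ite_le zero_le_one,
      intervalIntegral.integral_mul_const, integral_rpow (.inl (by linarith)), plateauMoment_zero,
      Real.zero_rpow (by linarith)]
    simp
    ring
  · have hc : 0 ≤ 1 - s := by linarith [hs.2]
    have hd : ∀ x ∈ Ioi (0 : ℝ), x ^ q * plateauDensity s x
        = x ^ q * (1 / 2 * Real.exp (-(s⁻¹ * max (x - (1 - s)) 0))) := by
      intro x hx
      rw [plateauDensity, abs_of_pos hx, if_neg h0.ne']
    have h1 : ∀ x ∈ Ioc 0 (1 - s), x ^ q * (1 / 2 * Real.exp (-(s⁻¹ * max (x - (1 - s)) 0)))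
        = x ^ q * (1 / 2) := by
      intro x hx
      rw [max_eq_right (by linarith [hx.2])]
      simp
    have h2 : ∀ x ∈ Ioi (0 : ℝ), (1 - s + s * x) ^ q *
        (1 / 2 * Real.exp (-(s⁻¹ * max (1 - s + s * x - (1 - s)) 0)))
        = 1 / 2 * ((1 - s + s * x) ^ q * Real.exp (-x)) := by
      intro x hx
      rw [max_eq_left (by have : 0 < s * x := mul_pos h0 hx; linarith)]
      have : s⁻¹ * (1 - s + s * x - (1 - s)) = x := by field_simp; ring
      rw [this]
      ring
    have i1 : IntegrableOn (fun x : ℝ => x ^ q * (1 / 2 * Real.exp (-(s⁻¹ * max (x - (1 - s)) 0))))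
        (Ioc 0 (1 - s)) := by
      have : Continuous (fun x : ℝ => x ^ q * (1 / 2 * Real.exp (-(s⁻¹ * max (x - (1 - s)) 0)))) :=
        (Real.continuous_rpow_const hq).mul (by fun_prop)
      exact this.integrableOn_Ioc
    have v2 := setIntegral_Ioi_comp_add_mul
      (fun x : ℝ => x ^ q * (1 / 2 * Real.exp (-(s⁻¹ * max (x - (1 - s)) 0)))) (1 - s) h0
    rw [setIntegral_congr_fun measurableSet_Ioi h2, integral_const_mul] at v2
    -- Strict positivity makes the tail integral nonzero, from which integrability on the tail is
    -- read off below.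
    have hpos : 0 < ∫ v in Ioi (0 : ℝ), (1 - s + s * v) ^ q * Real.exp (-v) := by
      refine (setIntegral_pos_iff_support_of_nonneg_ae ?_
        (integrableOn_one_sub_add_mul_rpow hq hs)).2 ?_
      · filter_upwards [self_mem_ae_restrict measurableSet_Ioi] with v hv
        have := (one_sub_add_mul_bounds hs hv).1
        simp only [Pi.zero_apply]
        positivity
      · refine lt_of_lt_of_le ?_ (measure_mono (s := Ioi 0) fun v hv => ⟨?_, hv⟩)
        · simp
        · have : 0 < s * v := mul_pos h0 hv
          have : 0 < 1 - s + s * v := by linarith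
          simp only [Function.mem_support]
          positivity
    have i2 : IntegrableOn (fun x : ℝ => x ^ q * (1 / 2 * Real.exp (-(s⁻¹ * max (x - (1 - s)) 0))))
        (Ioi (1 - s)) := by
      refine Integrable.of_integral_ne_zero ?_
      rw [v2]
      positivity
    rw [setIntegral_congr_fun measurableSet_Ioi hd, ← Ioc_union_Ioi_eq_Ioi hc,
      setIntegral_union (Ioc_disjoint_Ioi le_rfl) measurableSet_Ioi i1 i2, v2,
      setIntegral_congr_fun measurableSet_Ioc h1, ← intervalIntegral.integral_of_le hc,
      intervalIntegral.integral_mul_const, integral_rpow (.inl (by linarith)),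
      Real.zero_rpow (by linarith), plateauMoment]
    ring

/-! ### Moments of truncated exponentials. -/

/-- The moment of order `q` of `exp (-t * x)` on the unit interval. -/
noncomputable def truncMoment (q t : ℝ) : ℝ := ∫ x in (0 : ℝ)..1, x ^ q * Real.exp (-(t * x))

theorem continuous_truncMoment {q : ℝ} (hq : 0 ≤ q) : Continuous (truncMoment q) := by
  refine intervalIntegral.continuous_parametric_intervalIntegral_of_continuous' ?_ 0 1
  have : Continuous fun z : ℝ × ℝ => z.2 ^ q := (Real.continuous_rpow_const hq).comp continuous_snd
  exact this.mul (by fun_prop)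

theorem truncMoment_pos {q : ℝ} (hq : 0 ≤ q) (t : ℝ) : 0 < truncMoment q t := by
  refine intervalIntegral.intervalIntegral_pos_of_pos_on ?_ ?_ one_pos
  · exact (((Real.continuous_rpow_const hq).mul (by fun_prop)).intervalIntegrable _ _)
  · intro x hx
    have := hx.1
    positivity

theorem truncMoment_zero {q : ℝ} (hq : 0 ≤ q) : truncMoment q 0 = 1 / (q + 1) := by
  simp [truncMoment, integral_rpow (.inl (by linarith : -1 < q)),
    Real.zero_rpow (by linarith : q + 1 ≠ 0)]

theorem truncMoment_order_zero {t : ℝ} (ht : t ≠ 0) :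
    truncMoment 0 t = (1 - Real.exp (-t)) / t := by
  have : ∀ x : ℝ, x ^ (0 : ℝ) * Real.exp (-(t * x)) = Real.exp (-t * x) := by
    intro x
    simp
  simp_rw [truncMoment, this]
  rw [intervalIntegral.integral_comp_mul_left (fun x => Real.exp x) (neg_ne_zero.2 ht)]
  simp
  field_simp
  ring

/-- The substitution x ↦ t * x produces an incomplete Gamma integral, whose limit as t → ∞ is known.
-/
theorem rpow_mul_truncMoment {q t : ℝ} (ht : 0 < t) :
    t ^ (q + 1) * truncMoment q t = ∫ x in (0 : ℝ)..t, x ^ q * Real.exp (-x) := by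
  have h := intervalIntegral.integral_comp_mul_left (a := 0) (b := 1)
    (fun x => x ^ q * Real.exp (-x)) ht.ne'
  have e : ∀ x ∈ uIcc (0 : ℝ) 1, (t * x) ^ q * Real.exp (-(t * x))
      = t ^ q * (x ^ q * Real.exp (-(t * x))) := by
    intro x hx
    rw [uIcc_of_le zero_le_one] at hx
    rw [Real.mul_rpow ht.le hx.1]
    ring
  rw [intervalIntegral.integral_congr e, intervalIntegral.integral_const_mul, mul_zero, mul_one,
    smul_eq_mul] at h
  rw [Real.rpow_add_one ht.ne', truncMoment, mul_comm (t ^ q), mul_assoc, h]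
  field_simp

theorem tendsto_rpow_mul_truncMoment {q : ℝ} (hq : 0 ≤ q) :
    Filter.Tendsto (fun t => t ^ (q + 1) * truncMoment q t) Filter.atTop
      (nhds (Real.Gamma (q + 1))) := by
  have hi : IntegrableOn (fun x : ℝ => x ^ q * Real.exp (-x)) (Ioi 0) := by
    simpa [mul_comm] using Real.GammaIntegral_convergent (by linarith : 0 < q + 1)
  have h := intervalIntegral_tendsto_integral_Ioi 0 hi Filter.tendsto_id
  have e : ∫ x in Ioi (0 : ℝ), x ^ q * Real.exp (-x) = Real.Gamma (q + 1) := by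
    simp [Real.Gamma_eq_integral (by linarith : 0 < q + 1), mul_comm]
  rw [e] at h
  refine h.congr' ?_
  filter_upwards [Filter.eventually_gt_atTop 0] with t ht
  exact (rpow_mul_truncMoment ht).symm

/-- The two-sided exponential density of rate `t` truncated to `[-1, 1]`. -/
noncomputable def truncDensity (t x : ℝ) : ℝ :=
  (2 * truncMoment 0 t)⁻¹ * if |x| ≤ 1 then Real.exp (-(t * |x|)) else 0

theorem hasAbsMoment_truncDensity {q t : ℝ} (hq : 0 ≤ q) :
    HasAbsMoment q (truncMoment q t / truncMoment 0 t) (truncDensity t) := by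
  have h0 := truncMoment_pos le_rfl t
  refine .of_half (div_pos (truncMoment_pos hq t) h0).ne' (fun x => by simp [truncDensity]) ?_
  have : ∀ x ∈ Ioi (0 : ℝ), x ^ q * truncDensity t x
      = (2 * truncMoment 0 t)⁻¹ * if x ≤ 1 then x ^ q * Real.exp (-(t * x)) else 0 := by
    intro x hx
    rw [truncDensity, abs_of_pos hx]
    split_ifs <;> ring
  rw [setIntegral_congr_fun measurableSet_Ioi this, integral_const_mul,
    setIntegral_Ioi_ite_le zero_le_one, truncMoment.eq_def q]
  field_simp

/-! ### Both families as dilations of one-parameter curves. -/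

theorem abs_inv_mul_le_one_iff {l x : ℝ} (hl : 0 < l) : |l⁻¹ * x| ≤ 1 ↔ |x| ≤ l := by
  rw [abs_mul, abs_of_pos (inv_pos.2 hl), inv_mul_le_iff₀ hl, mul_one]

theorem uniformDensity_eq_dilate_plateauDensity {l : ℝ} (hl : 0 < l) :
    uniformDensity l = dilate l (plateauDensity 0) := by
  ext x
  simp only [dilate, plateauDensity, uniformDensity, indicator, if_true,
    abs_inv_mul_le_one_iff hl, mem_Icc, ← abs_le]
  split_ifs <;> simp

theorem max_inv_mul_sub {l c x : ℝ} (hl : 0 < l) :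
    max (|l⁻¹ * x| - c) 0 = l⁻¹ * max (|x| - l * c) 0 := by
  rw [mul_max_of_nonneg _ _ (inv_pos.2 hl).le, mul_sub, inv_mul_cancel_left₀ hl.ne', mul_zero,
    abs_mul, abs_of_pos (inv_pos.2 hl)]

/-- The dictionary is l = α + 1/γ and s = (1/γ) / l, hence α = l * (1 - s) and γ = 1 / (l * s). The
end s = 0 is γ = ∞ and the end s = 1 is α = 0. -/
theorem dilate_plateauDensity_mem_familyMinus {l s : ℝ} (hl : 0 < l) (hs : s ∈ Icc (0 : ℝ) 1) :
    dilate l (plateauDensity s) ∈ familyMinus := by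
  rcases hs.1.eq_or_lt with rfl | h0
  · refine ⟨l.toNNReal, ∞, by simp, by simpa using hl, ?_⟩
    ext x
    rw [fDensity, if_pos rfl, Real.coe_toNNReal l hl.le, uniformDensity_eq_dilate_plateauDensity hl]
  · have h1 : 0 ≤ 1 - s := by linarith [hs.2]
    refine ⟨(l * (1 - s)).toNNReal, ENNReal.ofReal (l * s)⁻¹, ?_, by simp, ?_⟩
    · rw [ENNReal.ofReal_pos]
      positivity
    · ext x
      have e1 : -(s⁻¹ * (l⁻¹ * max (|x| - l * (1 - s)) 0))
          = -(l * s)⁻¹ * max (|x| - l * (1 - s)) 0 := by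
        field_simp
      have e2 : l * (1 - s) + 1 / (l * s)⁻¹ = l := by field_simp; ring
      rw [fDensity, if_neg ENNReal.ofReal_ne_top, Real.coe_toNNReal _ (by positivity),
        ENNReal.toReal_ofReal (by positivity), dilate, plateauDensity, if_neg h0.ne',
        max_inv_mul_sub hl, e1, e2]
      field_simp

theorem exists_dilate_plateauDensity {f : ℝ → ℝ} (hf : f ∈ familyMinus) :
    ∃ l s : ℝ, 0 < l ∧ s ∈ Icc (0 : ℝ) 1 ∧ f = dilate l (plateauDensity s) := by
  obtain ⟨α, γ, hγ, hne, rfl⟩ := hf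
  by_cases ht : γ = ∞
  · have hα : (0 : ℝ) < α := NNReal.coe_pos.2 (pos_iff_ne_zero.2 fun h => hne ⟨h, ht⟩)
    refine ⟨α, 0, hα, by simp, ?_⟩
    ext x
    rw [fDensity, if_pos ht, uniformDensity_eq_dilate_plateauDensity hα]
  · have hg : 0 < γ.toReal := ENNReal.toReal_pos hγ.ne' ht
    have hα : (0 : ℝ) ≤ α := α.2
    unfold fDensity
    simp only [if_neg ht]
    generalize γ.toReal = g at hg ⊢
    generalize (α : ℝ) = c at hα ⊢
    have hl : 0 < c + 1 / g := by positivity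
    have hs : 0 < 1 / g / (c + 1 / g) := by positivity
    refine ⟨c + 1 / g, 1 / g / (c + 1 / g), hl, ⟨hs.le, ?_⟩, ?_⟩
    · rw [div_le_one hl]
      linarith
    · ext x
      have e : (c + 1 / g) * (1 - 1 / g / (c + 1 / g)) = c := by field_simp; ring
      have e1 : -((1 / g / (c + 1 / g))⁻¹ * ((c + 1 / g)⁻¹ * max (|x| - c) 0))
          = -g * max (|x| - c) 0 := by
        field_simp
      rw [dilate, plateauDensity, if_neg hs.ne', max_inv_mul_sub hl, e, e1]
      field_simp

theorem uniformDensity_eq_dilate {l : ℝ} (hl : 0 < l) :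
    uniformDensity l = dilate l (truncDensity 0) := by
  ext x
  simp only [dilate, truncDensity, uniformDensity, indicator, truncMoment_zero le_rfl, mem_Icc,
    ← abs_le, abs_inv_mul_le_one_iff hl]
  split_ifs <;> simp

theorem gDensity_eq_dilate {α γ : ℝ} (hα : 0 < α) (hγ : 0 < γ) (x : ℝ) :
    γ / (2 * (1 - Real.exp (-(α * γ)))) *
      {y : ℝ | |y| ≤ α}.indicator (fun y => Real.exp (-γ * |y|)) x
      = dilate α (truncDensity (α * γ)) x := by
  have hαγ : 0 < α * γ := mul_pos hα hγ
  have he : 0 < 1 - Real.exp (-(α * γ)) := by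
    have : Real.exp (-(α * γ)) < 1 := by rw [Real.exp_lt_one_iff]; linarith
    linarith
  simp only [dilate, truncDensity, indicator, mem_ofPred_eq, truncMoment_order_zero hαγ.ne',
    abs_inv_mul_le_one_iff hα]
  have e1 : -(α * γ * |α⁻¹ * x|) = -γ * |x| := by
    rw [abs_mul, abs_of_pos (inv_pos.2 hα)]
    field_simp
  rw [e1]
  split_ifs
  · field_simp
  · simp

theorem twoSidedExpDensity_eq_dilate {γ : ℝ} (hγ : 0 < γ) :
    twoSidedExpDensity γ = dilate γ⁻¹ (plateauDensity 1) := by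
  ext x
  simp [twoSidedExpDensity, dilate, plateauDensity, abs_mul, abs_of_pos hγ,
    max_eq_left (mul_nonneg hγ.le (abs_nonneg x))]
  ring

/-- Here l = α and t = α * γ. The case α = ∞ is not reached by finite t and is kept apart as a
dilated `plateauDensity 1`. -/
theorem dilate_truncDensity_mem_familyPlus {l t : ℝ} (hl : 0 < l) (ht : 0 ≤ t) :
    dilate l (truncDensity t) ∈ familyPlus := by
  refine ⟨ENNReal.ofReal l, (t / l).toNNReal, by simpa using hl, by simp, ?_⟩
  ext x
  rcases ht.eq_or_lt with rfl | ht
  · rw [gDensity, if_pos (by simp), ENNReal.toReal_ofReal hl.le, uniformDensity_eq_dilate hl]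
  · have h : 0 < t / l := div_pos ht hl
    rw [gDensity, if_neg (by simpa using h), if_neg ENNReal.ofReal_ne_top,
      ENNReal.toReal_ofReal hl.le, Real.coe_toNNReal _ h.le, gDensity_eq_dilate hl h,
      mul_div_cancel₀ t hl.ne']

theorem dilate_plateauDensity_one_mem_familyPlus {l : ℝ} (hl : 0 < l) :
    dilate l (plateauDensity 1) ∈ familyPlus := by
  have h : 0 < l⁻¹ := inv_pos.2 hl
  refine ⟨∞, l⁻¹.toNNReal, by simp, by simpa using hl, ?_⟩
  ext x
  rw [gDensity, if_neg (by simpa using hl), if_pos rfl, Real.coe_toNNReal _ h.le,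
    twoSidedExpDensity_eq_dilate h, inv_inv]

theorem exists_dilate_of_mem_familyPlus {f : ℝ → ℝ} (hf : f ∈ familyPlus) :
    (∃ l t : ℝ, 0 < l ∧ 0 ≤ t ∧ f = dilate l (truncDensity t)) ∨
      ∃ l : ℝ, 0 < l ∧ f = dilate l (plateauDensity 1) := by
  obtain ⟨α, γ, hα, hne, rfl⟩ := hf
  by_cases hγ : γ = 0
  · have ht : α ≠ ∞ := fun h => hne ⟨h, hγ⟩
    have ha : 0 < α.toReal := ENNReal.toReal_pos hα.ne' ht
    refine .inl ⟨α.toReal, 0, ha, le_rfl, ?_⟩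
    ext x
    rw [gDensity, if_pos hγ, uniformDensity_eq_dilate ha]
  · have hg : (0 : ℝ) < γ := NNReal.coe_pos.2 (pos_iff_ne_zero.2 hγ)
    by_cases ht : α = ∞
    · refine .inr ⟨(γ : ℝ)⁻¹, inv_pos.2 hg, ?_⟩
      ext x
      rw [gDensity, if_neg hγ, if_pos ht, twoSidedExpDensity_eq_dilate hg]
    · have ha : 0 < α.toReal := ENNReal.toReal_pos hα.ne' ht
      refine .inl ⟨α.toReal, α.toReal * γ, ha, by positivity, ?_⟩
      ext x
      rw [gDensity, if_neg hγ, if_neg ht, gDensity_eq_dilate ha hg]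

/-! ### Existence by the intermediate value theorem. -/

/-- Any symmetric density can be dilated to the second moment `a ^ 2`. -/
theorem exists_dilate_hasAbsMoment {p a m₂ m : ℝ} {f : ℝ → ℝ} (ha : 0 < a) (hm₂ : 0 < m₂)
    (h₂ : HasAbsMoment 2 m₂ f) (h : HasAbsMoment p m f) :
    ∃ l, 0 < l ∧ HasAbsMoment 2 (a ^ 2) (dilate l f) ∧
      HasAbsMoment p (a ^ p * (m / m₂ ^ (p / 2))) (dilate l f) := by
  have hs : 0 < √m₂ := Real.sqrt_pos.2 hm₂
  have hl : 0 < a / √m₂ := by positivity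
  refine ⟨a / √m₂, hl, ?_, ?_⟩
  · convert h₂.dilate hl using 1
    rw [Real.rpow_two, div_pow, Real.sq_sqrt hm₂.le]
    field_simp
  · convert h.dilate hl using 1
    rw [Real.div_rpow ha.le hs.le, Real.sqrt_eq_rpow, ← Real.rpow_mul hm₂.le,
      show 1 / 2 * p = p / 2 by ring]
    ring

/-- The scale-invariant ratio of the moments of order `p` and `2` of `plateauDensity s`. -/
noncomputable def plateauRatio (p s : ℝ) : ℝ := plateauMoment p s / plateauMoment 2 s ^ (p / 2)

/-- Raised to the power p, the bounds become 3 ^ (p / 2) / (p + 1) and Γ(p + 1) / 2 ^ (p / 2), the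
moment ratios of the uniform and the two-sided exponential density. -/
theorem feasible_iff {p a b : ℝ} (hp : 2 < p) (ha : 0 < a) (hb : 0 < b) :
    Feasible p a b ↔ plateauRatio p 0 ≤ (b / a) ^ p ∧ (b / a) ^ p ≤ plateauRatio p 1 := by
  have hp0 : 0 < p := by linarith
  have hG : 0 < Real.Gamma (p + 1) := Real.Gamma_pos_of_pos (by linarith)
  have e0 : plateauRatio p 0 = ((3 : ℝ) ^ (1 / 2 : ℝ) * (p + 1) ^ (-1 / p)) ^ p := by
    rw [Real.mul_rpow (by positivity) (by positivity), ← Real.rpow_mul (by norm_num),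
      ← Real.rpow_mul (by linarith), div_mul_cancel₀ _ hp0.ne', Real.rpow_neg_one, plateauRatio,
      plateauMoment_zero, plateauMoment_zero, Real.div_rpow (by norm_num) (by norm_num),
      Real.one_rpow, show 1 / 2 * p = p / 2 by ring, show (2 : ℝ) + 1 = 3 by norm_num]
    field_simp
  have e1 : plateauRatio p 1
      = ((2 : ℝ) ^ (-1 / 2 : ℝ) * Real.Gamma (p + 1) ^ (1 / p)) ^ p := by
    have hg3 : Real.Gamma (2 + 1) = 2 := by
      rw [Real.Gamma_add_one (by norm_num), Real.Gamma_two, mul_one]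
    rw [Real.mul_rpow (by positivity) (by positivity), ← Real.rpow_mul (by norm_num),
      ← Real.rpow_mul hG.le, div_mul_cancel₀ _ hp0.ne', Real.rpow_one, plateauRatio,
      plateauMoment_one hp0.le, plateauMoment_one (by norm_num), hg3,
      show -1 / 2 * p = -(p / 2) by ring, Real.rpow_neg (by norm_num)]
    field_simp
  rw [e0, e1, Feasible, Real.rpow_le_rpow_iff (by positivity) (by positivity) hp0,
    Real.rpow_le_rpow_iff (by positivity) (by positivity) hp0]

theorem rpow_mul_eq_of_ratio_eq {p a b R : ℝ} (ha : 0 < a) (hb : 0 < b) (h : R = (b / a) ^ p) :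
    a ^ p * R = b ^ p := by
  rw [h, Real.div_rpow hb.le ha.le, mul_div_cancel₀ _ (Real.rpow_pos_of_pos ha p).ne']

theorem exists_mem_familyMinus {p a b : ℝ} (hp : 2 < p) (ha : 0 < a) (hb : 0 < b)
    (h : Feasible p a b) : ∃ f ∈ familyMinus, HasMoments p a b f := by
  rw [feasible_iff hp ha hb] at h
  have hc : ContinuousOn (plateauRatio p) (Icc 0 1) := by
    refine (continuousOn_plateauMoment (by linarith)).div
      ((continuousOn_plateauMoment (by norm_num)).rpow_const fun _ _ => .inr (by linarith)) ?_
    intro s hs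
    exact (Real.rpow_pos_of_pos (plateauMoment_pos (by norm_num) hs) _).ne'
  obtain ⟨s, hs, hR⟩ := intermediate_value_Icc zero_le_one hc h
  obtain ⟨l, hl, h2, hq⟩ := exists_dilate_hasAbsMoment ha (plateauMoment_pos (by norm_num) hs)
    (hasAbsMoment_plateauDensity (by norm_num) hs)
    (hasAbsMoment_plateauDensity (by linarith : 0 ≤ p) hs)
  refine ⟨_, dilate_plateauDensity_mem_familyMinus hl hs, hasMoments_iff.2 ⟨h2, ?_⟩⟩
  rwa [← rpow_mul_eq_of_ratio_eq ha hb hR]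

/-- The scale-invariant ratio of the moments of order `p` and `2` of `truncDensity t`. -/
noncomputable def truncRatio (p t : ℝ) : ℝ :=
  truncMoment p t / truncMoment 0 t / (truncMoment 2 t / truncMoment 0 t) ^ (p / 2)

theorem continuous_truncRatio {p : ℝ} (hp : 2 < p) : Continuous (truncRatio p) := by
  have h0 : ∀ t, truncMoment 0 t ≠ 0 := fun t => (truncMoment_pos le_rfl t).ne'
  have c0 := continuous_truncMoment (q := 0) le_rfl
  refine ((continuous_truncMoment (by linarith)).div c0 h0).div
    (((continuous_truncMoment (by norm_num)).div c0 h0).rpow_const fun _ => .inr (by linarith)) ?_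
  intro t
  exact (Real.rpow_pos_of_pos
    (div_pos (truncMoment_pos (by norm_num) t) (truncMoment_pos le_rfl t)) _).ne'

theorem truncRatio_zero {p : ℝ} (hp : 2 < p) : truncRatio p 0 = plateauRatio p 0 := by
  simp [truncRatio, plateauRatio, truncMoment_zero, plateauMoment_zero,
    truncMoment_zero (by linarith : 0 ≤ p)]

/-- Rescaling by t turns each moment into one with a Gamma limit. The powers of t cancel because the
ratio is invariant under dilation. -/
theorem tendsto_truncRatio {p : ℝ} (hp : 2 < p) :
    Filter.Tendsto (truncRatio p) Filter.atTop (nhds (plateauRatio p 1)) := by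
  have l0 := tendsto_rpow_mul_truncMoment (q := 0) le_rfl
  have l2 := tendsto_rpow_mul_truncMoment (q := 2) (by norm_num)
  have lp := tendsto_rpow_mul_truncMoment (q := p) (by linarith)
  have g0 : Real.Gamma (0 + 1) = 1 := by simp
  have g2 : 0 < Real.Gamma (2 + 1) := Real.Gamma_pos_of_pos (by norm_num)
  rw [g0] at l0
  have l := (lp.div l0 one_ne_zero).div
    ((l2.div l0 one_ne_zero).rpow_const (p := p / 2) (.inr (by linarith)))
    (by rw [div_one]; exact (Real.rpow_pos_of_pos g2 _).ne')
  rw [div_one, div_one, ← plateauMoment_one (by linarith), ← plateauMoment_one (by norm_num)] at l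
  refine l.congr' ?_
  filter_upwards [Filter.eventually_gt_atTop 0] with t ht
  have h0 := truncMoment_pos le_rfl t
  have h2 := truncMoment_pos (by norm_num : (0 : ℝ) ≤ 2) t
  have e : ∀ q : ℝ, t ^ (q + 1) * truncMoment q t / (t ^ ((0 : ℝ) + 1) * truncMoment 0 t)
      = t ^ q * (truncMoment q t / truncMoment 0 t) := by
    intro q
    rw [Real.rpow_add_one ht.ne', zero_add, Real.rpow_one]
    field_simp
  simp only [Pi.div_apply, e]
  rw [Real.mul_rpow (by positivity) (by positivity), ← Real.rpow_mul ht.le,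
    mul_div_cancel₀ p two_ne_zero, truncRatio, mul_div_mul_left _ _ (by positivity)]

theorem exists_mem_familyPlus {p a b : ℝ} (hp : 2 < p) (ha : 0 < a) (hb : 0 < b)
    (h : Feasible p a b) : ∃ f ∈ familyPlus, HasMoments p a b f := by
  rw [feasible_iff hp ha hb] at h
  -- The upper endpoint is only the limit t → ∞, so equality is served by the exponential density
  -- itself. Below it, some finite T already exceeds the target.
  rcases h.2.eq_or_lt with h1 | h1
  · have hs : (1 : ℝ) ∈ Icc (0 : ℝ) 1 := by simp
    obtain ⟨l, hl, h2, hq⟩ := exists_dilate_hasAbsMoment ha (plateauMoment_pos (by norm_num) hs)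
      (hasAbsMoment_plateauDensity (by norm_num) hs)
      (hasAbsMoment_plateauDensity (by linarith : 0 ≤ p) hs)
    refine ⟨_, dilate_plateauDensity_one_mem_familyPlus hl, hasMoments_iff.2 ⟨h2, ?_⟩⟩
    rwa [← rpow_mul_eq_of_ratio_eq ha hb h1.symm]
  · obtain ⟨T, hT, hT0⟩ := (((tendsto_truncRatio hp).eventually_const_lt h1).and
      (Filter.eventually_ge_atTop 0)).exists
    obtain ⟨t, ht, hR⟩ := intermediate_value_Icc hT0 (continuous_truncRatio hp).continuousOn
      ⟨(truncRatio_zero hp).trans_le h.1, hT.le⟩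
    obtain ⟨l, hl, h2, hq⟩ := exists_dilate_hasAbsMoment ha
      (div_pos (truncMoment_pos (by norm_num) t) (truncMoment_pos le_rfl t))
      (hasAbsMoment_truncDensity (t := t) (by norm_num))
      (hasAbsMoment_truncDensity (t := t) (by linarith : 0 ≤ p))
    refine ⟨_, dilate_truncDensity_mem_familyPlus hl ht.1, hasMoments_iff.2 ⟨h2, ?_⟩⟩
    rwa [← rpow_mul_eq_of_ratio_eq ha hb hR]

/-! ### From equality a.e. to equality everywhere. -/

/-- `f` is continuous, or the restriction of a continuous function to a symmetric interval,
extended by zero. -/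
def IsCutoff (f : ℝ → ℝ) : Prop :=
  ∃ k : ℝ → ℝ, Continuous k ∧ (f = k ∨ ∃ α > 0, ∀ x, f x = if |x| ≤ α then k x else 0)

/-- Approaching x from the side of the origin never meets the jump, because the cutoff interval is
closed. -/
theorem IsCutoff.tendsto {f : ℝ → ℝ} (hf : IsCutoff f) (x : ℝ) :
    (0 < x → Filter.Tendsto f (𝓝[<] x) (𝓝 (f x))) ∧
      (x ≤ 0 → Filter.Tendsto f (𝓝[>] x) (𝓝 (f x))) := by
  obtain ⟨k, hk, rfl | ⟨α, hα, hfk⟩⟩ := hf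
  · exact ⟨fun _ => hk.continuousWithinAt, fun _ => hk.continuousWithinAt⟩
  rcases le_or_gt |x| α with h | h
  · rw [hfk x, if_pos h]
    rw [abs_le] at h
    refine ⟨fun hx => (hk.tendsto x).mono_left nhdsWithin_le_nhds |>.congr' ?_,
      fun hx => (hk.tendsto x).mono_left nhdsWithin_le_nhds |>.congr' ?_⟩
    · filter_upwards [self_mem_nhdsWithin, nhdsWithin_le_nhds (lt_mem_nhds hx)] with y hy hy'
      rw [hfk, if_pos]
      rw [abs_of_pos hy']
      exact (le_of_lt hy).trans h.2
    · filter_upwards [self_mem_nhdsWithin,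
        nhdsWithin_le_nhds (gt_mem_nhds (hx.trans_lt hα))] with y hy hy'
      rw [hfk, if_pos]
      exact abs_le.2 ⟨h.1.trans (le_of_lt hy), le_of_lt hy'⟩
  · have : f =ᶠ[𝓝 x] fun _ => f x := by
      filter_upwards [continuous_abs.continuousAt.eventually (lt_mem_nhds h)] with y hy
      rw [hfk, hfk, if_neg (not_le.2 hy), if_neg (not_le.2 h)]
    have ht : Filter.Tendsto f (𝓝 x) (𝓝 (f x)) := tendsto_const_nhds.congr' this.symm
    exact ⟨fun _ => ht.mono_left nhdsWithin_le_nhds, fun _ => ht.mono_left nhdsWithin_le_nhds⟩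

theorem IsCutoff.eq_of_ae_eq {f g : ℝ → ℝ} (hf : IsCutoff f) (hg : IsCutoff g)
    (h : f =ᵐ[volume] g) : f = g := by
  have hd : Dense {x | f x = g x} := Measure.dense_of_ae h
  have key : ∀ (x : ℝ) (U : Set ℝ), IsOpen U → x ∈ closure U → ∃ᶠ y in 𝓝[U] x, f y = g y := by
    intro x U hU hx
    have hx' : x ∈ closure (U ∩ {x | f x = g x}) :=
      closure_minimal (hd.open_subset_closure_inter hU) isClosed_closure hx
    rw [frequently_nhdsWithin_iff]
    exact (mem_closure_iff_frequently.1 hx').mono fun y hy => ⟨hy.2, hy.1⟩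
  ext x
  rcases lt_or_ge 0 x with hx | hx
  · exact tendsto_nhds_unique_of_frequently_eq ((hf.tendsto x).1 hx) ((hg.tendsto x).1 hx)
      (key x _ isOpen_Iio (by simp))
  · exact tendsto_nhds_unique_of_frequently_eq ((hf.tendsto x).2 hx) ((hg.tendsto x).2 hx)
      (key x _ isOpen_Ioi (by simp))

theorem isCutoff_dilate_plateauDensity {l : ℝ} (hl : 0 < l) (s : ℝ) :
    IsCutoff (dilate l (plateauDensity s)) := by
  by_cases hs : s = 0
  · refine ⟨fun _ => l⁻¹ * (1 / 2), continuous_const, .inr ⟨l, hl, fun x => ?_⟩⟩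
    simp only [dilate, plateauDensity, if_pos hs, abs_inv_mul_le_one_iff hl]
    split_ifs <;> simp
  · refine ⟨_, ?_, .inl rfl⟩
    unfold dilate plateauDensity
    simp only [if_neg hs]
    fun_prop

theorem isCutoff_dilate_truncDensity {l : ℝ} (hl : 0 < l) (t : ℝ) :
    IsCutoff (dilate l (truncDensity t)) := by
  refine ⟨fun x => l⁻¹ * ((2 * truncMoment 0 t)⁻¹ * Real.exp (-(t * |l⁻¹ * x|))), by fun_prop,
    .inr ⟨l, hl, fun x => ?_⟩⟩
  simp only [dilate, truncDensity, abs_inv_mul_le_one_iff hl]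
  split_ifs <;> simp

/-! ### Uniqueness in each family. -/

/-- After taking logarithms, this is the solution set of an affine inequality. -/
theorem ordConnected_exp_lt_exp {A B : ℝ} (hA : 0 < A) (hB : 0 < B) (a b : ℝ) :
    {x : ℝ | A * Real.exp (-(a * x)) < B * Real.exp (-(b * x))}.OrdConnected := by
  have e : ∀ x : ℝ, A * Real.exp (-(a * x)) < B * Real.exp (-(b * x)) ↔
      Real.log A - a * x < Real.log B - b * x := by
    intro x
    nth_rw 1 [← Real.exp_log hA, ← Real.exp_log hB]
    rw [← Real.exp_add, ← Real.exp_add, Real.exp_lt_exp]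
    rfl
  simp only [e]
  refine ⟨fun x hx z hz y hy => ?_⟩
  simp only [mem_ofPred_eq] at hx hz ⊢
  rcases le_total b a with h | h
  · nlinarith [hy.1, mul_le_mul_of_nonneg_left hy.1 (sub_nonneg.2 h)]
  · nlinarith [hy.2, mul_le_mul_of_nonneg_left hy.2 (sub_nonneg.2 h)]

theorem absMoment_le_of_ordConnected {p a m m' : ℝ} (hp : 2 < p) {f g : ℝ → ℝ}
    (hfe : ∀ x, f |x| = f x) (hge : ∀ x, g |x| = g x)
    (hf0 : HasAbsMoment 0 1 f) (hg0 : HasAbsMoment 0 1 g)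
    (hf2 : HasAbsMoment 2 (a ^ 2) f) (hg2 : HasAbsMoment 2 (a ^ 2) g)
    (hf : HasAbsMoment p m f) (hg : HasAbsMoment p m' g)
    (hN : {x | 0 < x ∧ f x < g x}.OrdConnected) :
    m' ≤ m ∧ (m' = m → f =ᵐ[volume] g) := by
  simp only [HasAbsMoment, Real.rpow_zero, one_mul] at hf0 hg0
  simp only [HasAbsMoment, Real.rpow_two, sq_abs] at hf2 hg2
  have e2 : ∀ x, x ^ 2 * (f x - g x) = x ^ 2 * f x - x ^ 2 * g x := fun x => by ring
  have ep : ∀ x, |x| ^ p * (f x - g x) = |x| ^ p * f x - |x| ^ p * g x := fun x => by ring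
  obtain ⟨hle, heq⟩ := integral_nonneg_of_ordConnected_neg hp (w := fun x => f x - g x)
    (fun x => by simp only [hfe, hge]) (hf0.1.sub hg0.1)
    (by simp_rw [e2]; exact hf2.1.sub hg2.1) (by simp_rw [ep]; exact hf.1.sub hg.1)
    (by rw [integral_sub hf0.1 hg0.1, hf0.2, hg0.2, sub_self])
    (by simp_rw [e2]; rw [integral_sub hf2.1 hg2.1, hf2.2, hg2.2, sub_self])
    (by simpa only [sub_neg] using hN)
  simp_rw [ep, integral_sub hf.1 hg.1, hf.2, hg.2] at hle heq
  refine ⟨by linarith, fun h => ?_⟩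
  filter_upwards [heq (by rw [h, sub_self])] with x hx
  exact sub_eq_zero.1 hx

theorem ae_eq_of_ordConnected {p a b : ℝ} (hp : 2 < p) {f g : ℝ → ℝ}
    (hfe : ∀ x, f |x| = f x) (hge : ∀ x, g |x| = g x)
    (hf0 : HasAbsMoment 0 1 f) (hg0 : HasAbsMoment 0 1 g)
    (hf : HasMoments p a b f) (hg : HasMoments p a b g)
    (hN : {x | 0 < x ∧ f x < g x}.OrdConnected) : f =ᵐ[volume] g := by
  rw [hasMoments_iff] at hf hg
  exact (absMoment_le_of_ordConnected hp hfe hge hf0 hg0 hf.1 hg.1 hf.2 hg.2 hN).2 rfl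

theorem dilate_plateauDensity_even (l s x : ℝ) :
    dilate l (plateauDensity s) |x| = dilate l (plateauDensity s) x := by
  simp [dilate, plateauDensity, abs_mul]

theorem hasAbsMoment_zero_dilate_plateauDensity {l s : ℝ} (hl : 0 < l) (hs : s ∈ Icc (0 : ℝ) 1) :
    HasAbsMoment 0 1 (dilate l (plateauDensity s)) := by
  simpa [plateauMoment_order_zero] using (hasAbsMoment_plateauDensity le_rfl hs).dilate hl

/-- `f` equals `c` on `[-α, α]`, and on the half-line beyond `α` it vanishes or decays
exponentially. -/
def IsPlateau (α c : ℝ) (f : ℝ → ℝ) : Prop :=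
  0 < c ∧ (∀ x, |x| ≤ α → f x = c) ∧
    ((∀ x, α < x → f x = 0) ∨ ∃ γ > 0, ∀ x, α ≤ x → f x = c * Real.exp (-(γ * (x - α))))

theorem isPlateau_dilate_plateauDensity {l s : ℝ} (hl : 0 < l) (hs : s ∈ Icc (0 : ℝ) 1) :
    IsPlateau (l * (1 - s)) (l⁻¹ * (1 / 2)) (dilate l (plateauDensity s)) := by
  have hα : 0 ≤ l * (1 - s) := mul_nonneg hl.le (by linarith [hs.2])
  refine ⟨by positivity, ?_⟩
  rcases hs.1.eq_or_lt with rfl | h0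
  · simp only [dilate, plateauDensity, if_true, abs_inv_mul_le_one_iff hl, sub_zero, mul_one]
    refine ⟨fun x hx => by rw [if_pos hx], .inl fun x hx => ?_⟩
    rw [if_neg (not_le.2 (hx.trans_le (le_abs_self x))), mul_zero]
  · simp only [dilate, plateauDensity, if_neg h0.ne', max_inv_mul_sub hl]
    refine ⟨fun x hx => ?_, .inr ⟨s⁻¹ * l⁻¹, by positivity, fun x hx => ?_⟩⟩
    · rw [max_eq_right (by linarith)]
      simp
    · rw [abs_of_nonneg (hα.trans hx), max_eq_left (by linarith)]
      ring_nf

theorem IsPlateau.le_of_nonneg {α c : ℝ} {f : ℝ → ℝ} (hf : IsPlateau α c f) {x : ℝ} (hx : 0 ≤ x) :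
    0 ≤ f x ∧ f x ≤ c := by
  obtain ⟨hc, h1, h2⟩ := hf
  rcases le_or_gt x α with h | h
  · rw [h1 x (by rwa [abs_of_nonneg hx])]
    exact ⟨hc.le, le_rfl⟩
  rcases h2 with h2 | ⟨γ, hγ, h2⟩
  · rw [h2 x h]
    exact ⟨le_rfl, hc.le⟩
  · rw [h2 x h.le]
    refine ⟨by positivity, mul_le_of_le_one_right hc.le (Real.exp_le_one_iff.2 ?_)⟩
    have := mul_pos hγ (sub_pos.2 h)
    linarith

theorem IsPlateau.antitone {α c : ℝ} {f : ℝ → ℝ} (hf : IsPlateau α c f) {x y : ℝ} (hx : 0 ≤ x)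
    (hxy : x ≤ y) : f y ≤ f x := by
  have hy := hf.le_of_nonneg (hx.trans hxy)
  have hx' := hf.le_of_nonneg hx
  obtain ⟨hc, h1, h2⟩ := hf
  rcases le_or_gt x α with h | h
  · rw [h1 x (by rwa [abs_of_nonneg hx])]
    exact hy.2
  rcases h2 with h2 | ⟨γ, hγ, h2⟩
  · rw [h2 y (h.trans_le hxy)]
    exact hx'.1
  · rw [h2 x h.le, h2 y (h.le.trans hxy)]
    gcongr

/-- Up to β, g is constant while f decreases, so f < g persists once it holds. Beyond β each
function is zero or a pure exponential, and `ordConnected_exp_lt_exp` covers the case of two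
exponentials. -/
theorem IsPlateau.ordConnected_lt {α β c d : ℝ} {f g : ℝ → ℝ} (hf : IsPlateau α c f)
    (hg : IsPlateau β d g) (h : α ≤ β) : {x | 0 < x ∧ f x < g x}.OrdConnected := by
  refine ⟨fun x hx z hz y hy => ⟨hx.1.trans_le hy.1, ?_⟩⟩
  have hstart : ∀ y, x ≤ y → y ≤ β → f y < g y := by
    intro y hxy hyβ
    have hxb : g x = d := hg.2.1 x (by rw [abs_of_pos hx.1]; exact hxy.trans hyβ)
    have hyb : g y = d := hg.2.1 y (by rwa [abs_of_pos (hx.1.trans_le hxy)])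
    rw [hyb, ← hxb]
    exact (hf.antitone hx.1.le hxy).trans_lt hx.2
  rcases le_or_gt y β with hyβ | hyβ
  · exact hstart y hy.1 hyβ
  have hzβ : β < z := hyβ.trans_le hy.2
  have hfz := (hf.le_of_nonneg hz.1.le).1
  obtain ⟨hd, -, hg2 | ⟨δ, hδ, hg2⟩⟩ := id hg
  · have := hz.2
    rw [hg2 z hzβ] at this
    linarith
  obtain ⟨hc, -, hf2 | ⟨γ, hγ, hf2⟩⟩ := id hf
  · rw [hf2 y (h.trans_lt hyβ), hg2 y hyβ.le]
    positivity
  -- The exponential formulas for both functions hold only from β on, so the left endpoint is moved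
  -- there.
  have hx' : f (max x β) < g (max x β) := by
    rcases le_total x β with hxβ | hxβ
    · rw [max_eq_right hxβ]
      exact hstart β hxβ le_rfl
    · rw [max_eq_left hxβ]
      exact hx.2
  have e : ∀ u, β ≤ u → (f u < g u ↔ c * Real.exp (γ * α) * Real.exp (-(γ * u))
      < d * Real.exp (δ * β) * Real.exp (-(δ * u))) := by
    intro u hu
    rw [hf2 u (h.trans hu), hg2 u hu, mul_assoc, mul_assoc, ← Real.exp_add, ← Real.exp_add]
    ring_nf
  rw [e _ hyβ.le]
  exact (ordConnected_exp_lt_exp (by positivity) (by positivity) γ δ).out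
    ((e _ (le_max_right _ _)).1 hx') ((e _ hzβ.le).1 hz.2) ⟨max_le hy.1 hyβ.le, hy.2⟩

theorem familyMinus_unique {p a b : ℝ} (hp : 2 < p) {f g : ℝ → ℝ} (hf : f ∈ familyMinus)
    (hg : g ∈ familyMinus) (hfm : HasMoments p a b f) (hgm : HasMoments p a b g) : f = g := by
  obtain ⟨l, s, hl, hs, rfl⟩ := exists_dilate_plateauDensity hf
  obtain ⟨l', s', hl', hs', rfl⟩ := exists_dilate_plateauDensity hg
  have hmass := hasAbsMoment_zero_dilate_plateauDensity hl hs
  have hmass' := hasAbsMoment_zero_dilate_plateauDensity hl' hs'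
  refine (isCutoff_dilate_plateauDensity hl s).eq_of_ae_eq
    (isCutoff_dilate_plateauDensity hl' s') ?_
  rcases le_total (l * (1 - s)) (l' * (1 - s')) with h | h
  · exact ae_eq_of_ordConnected hp (dilate_plateauDensity_even _ _)
      (dilate_plateauDensity_even _ _) hmass hmass' hfm hgm
      ((isPlateau_dilate_plateauDensity hl hs).ordConnected_lt
        (isPlateau_dilate_plateauDensity hl' hs') h)
  · exact (ae_eq_of_ordConnected hp (dilate_plateauDensity_even _ _)
      (dilate_plateauDensity_even _ _) hmass' hmass hgm hfm
      ((isPlateau_dilate_plateauDensity hl' hs').ordConnected_lt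
        (isPlateau_dilate_plateauDensity hl hs) h)).symm

theorem familyPlus_spec {f : ℝ → ℝ} (hf : f ∈ familyPlus) :
    IsCutoff f ∧ HasAbsMoment 0 1 f ∧ ∃ (I : Set ℝ) (c γ : ℝ), IsLowerSet I ∧ 0 < c ∧
      (∀ x, |x| ∈ I → f x = c * Real.exp (-(γ * |x|))) ∧ ∀ x, |x| ∉ I → f x = 0 := by
  rcases exists_dilate_of_mem_familyPlus hf with ⟨l, t, hl, ht, rfl⟩ | ⟨l, hl, rfl⟩
  · have h0 := truncMoment_pos le_rfl t
    refine ⟨isCutoff_dilate_truncDensity hl t, ?_, Iic l, l⁻¹ * (2 * truncMoment 0 t)⁻¹, t * l⁻¹,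
      isLowerSet_Iic l, by positivity, fun x hx => ?_, fun x hx => ?_⟩
    · simpa [div_self h0.ne'] using (hasAbsMoment_truncDensity (t := t) le_rfl).dilate hl
    · rw [dilate, truncDensity, if_pos ((abs_inv_mul_le_one_iff hl).2 hx), abs_mul,
        abs_of_pos (inv_pos.2 hl)]
      ring_nf
    · rw [dilate, truncDensity, if_neg fun h => hx ((abs_inv_mul_le_one_iff hl).1 h)]
      simp
  · refine ⟨isCutoff_dilate_plateauDensity hl 1, ?_, univ, l⁻¹ * (1 / 2), l⁻¹, isLowerSet_univ,
      by positivity, fun x _ => ?_, fun x hx => (hx (mem_univ _)).elim⟩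
    · exact hasAbsMoment_zero_dilate_plateauDensity hl (by simp)
    · rw [dilate, plateauDensity, if_neg one_ne_zero, max_inv_mul_sub hl, sub_self, mul_zero,
        sub_zero, max_eq_left (abs_nonneg x)]
      ring_nf

theorem familyPlus_unique {p a b : ℝ} (hp : 2 < p) {f g : ℝ → ℝ} (hf : f ∈ familyPlus)
    (hg : g ∈ familyPlus) (hfm : HasMoments p a b f) (hgm : HasMoments p a b g) : f = g := by
  obtain ⟨hfc, hf0, I, c, γ, hI, hc, hf1, hf2⟩ := familyPlus_spec hf
  obtain ⟨hgc, hg0, J, d, δ, hJ, hd, hg1, hg2⟩ := familyPlus_spec hg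
  -- Lower sets of a linear order are nested, so f may be taken to have the smaller support. Then g
  -- < f can occur only inside I, where both functions are exponentials.
  wlog hIJ : I ⊆ J generalizing f g I J c d γ δ
  · exact (this hg hf hgm hfm hgc hg0 J d δ hJ hd hg1 hg2 hfc hf0 I c γ hI hc hf1 hf2
      ((hI.total hJ).resolve_left hIJ)).symm
  have even : ∀ {f : ℝ → ℝ} {I : Set ℝ} {c γ : ℝ}, (∀ x, |x| ∈ I → f x = c * Real.exp (-(γ * |x|)))
      → (∀ x, |x| ∉ I → f x = 0) → ∀ x, f |x| = f x := by
    intro f I c γ h1 h2 x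
    by_cases hx : |x| ∈ I
    · rw [h1 x hx, h1 |x| (by rwa [abs_abs]), abs_abs]
    · rw [h2 x hx, h2 |x| (by rwa [abs_abs])]
  refine hfc.eq_of_ae_eq hgc (ae_eq_of_ordConnected hp (even hg1 hg2) (even hf1 hf2) hg0 hf0 hgm
    hfm ?_).symm
  have hmem : ∀ x, 0 < x → g x < f x → x ∈ I := by
    intro x hx hlt
    by_contra hn
    rw [hf2 x (by rwa [abs_of_pos hx])] at hlt
    by_cases hxJ : |x| ∈ J
    · rw [hg1 x hxJ] at hlt
      exact absurd hlt (not_lt.2 (by positivity))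
    · exact hlt.ne (hg2 x hxJ)
  have e : ∀ x, 0 < x → x ∈ I →
      (g x < f x ↔ d * Real.exp (-(δ * x)) < c * Real.exp (-(γ * x))) := by
    intro x hx hxI
    have hxa : |x| = x := abs_of_pos hx
    rw [hf1 x (by rwa [hxa]), hg1 x (by rw [hxa]; exact hIJ hxI), hxa]
  refine ⟨fun x hx z hz y hy => ?_⟩
  have hxI := hmem x hx.1 hx.2
  have hzI := hmem z hz.1 hz.2
  have hy0 : 0 < y := hx.1.trans_le hy.1
  refine ⟨hy0, (e y hy0 (hI hy.2 hzI)).2 ?_⟩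
  exact (ordConnected_exp_lt_exp hd hc δ γ).out ((e x hx.1 hxI).1 hx.2) ((e z hz.1 hzI).1 hz.2) hy

/-! ### Log-concave functions and their extremal moments. -/

/-- The function `h` is nonnegative and log-concave. -/
def IsLogConcaveFun (h : ℝ → ℝ) : Prop :=
  (∀ x, 0 ≤ h x) ∧ ∀ x y s t : ℝ, 0 < s → 0 < t → s + t = 1 →
    h x ^ s * h y ^ t ≤ h (s * x + t * y)

theorem IsConvexPotential.exists_isLogConcaveFun {φ : ℝ → EReal} (hφ : IsConvexPotential φ) :
    ∃ h : ℝ → ℝ, IsLogConcaveFun h ∧ ∀ x, EReal.exp (-φ x) = ENNReal.ofReal (h x) := by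
  refine ⟨fun x => (EReal.exp (-φ x)).toReal, ⟨fun x => ENNReal.toReal_nonneg, ?_⟩, fun x => ?_⟩
  · intro x y s t hs ht hst
    have hc := hφ.2 x y s t hs ht hst
    have hz := hφ.1 (s * x + t * y)
    have hx := hφ.1 x
    have hy := hφ.1 y
    beta_reduce
    generalize φ (s * x + t * y) = c at hc hz ⊢
    generalize φ x = a at hc hx ⊢
    generalize φ y = b at hc hy ⊢
    induction a with
    | bot => exact absurd rfl hx
    | top => simp [Real.zero_rpow hs.ne']
    | coe a =>
      induction b with
      | bot => exact absurd rfl hy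
      | top => simp [Real.zero_rpow ht.ne']
      | coe b =>
        have e : (s : EReal) * a + (t : EReal) * b = ((s * a + t * b : ℝ) : EReal) := by
          push_cast
          rfl
        rw [e] at hc
        induction c with
        | bot => exact absurd rfl hz
        | top => exact absurd (top_le_iff.1 hc) (EReal.coe_ne_top _)
        | coe c =>
          rw [EReal.coe_le_coe_iff] at hc
          simp only [← EReal.coe_neg, EReal.exp_coe, ENNReal.toReal_ofReal (Real.exp_pos _).le]
          rw [← Real.exp_mul, ← Real.exp_mul, ← Real.exp_add, Real.exp_le_exp]
          linarith
  · rw [ENNReal.ofReal_toReal]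
    rw [Ne, EReal.exp_eq_top_iff, EReal.neg_eq_top_iff]
    exact hφ.1 x

/-- Symmetry of a law makes its density even only a.e.; this minimum is an everywhere even version
that stays log-concave. -/
theorem IsLogConcaveFun.min_comp_neg {h : ℝ → ℝ} (hh : IsLogConcaveFun h) :
    IsLogConcaveFun fun x => min (h x) (h (-x)) := by
  refine ⟨fun x => le_min (hh.1 x) (hh.1 _), fun x y s t hs ht hst => ?_⟩
  have n : ∀ x, 0 ≤ min (h x) (h (-x)) := fun x => le_min (hh.1 x) (hh.1 _)
  refine le_min ((mul_le_mul ?_ ?_ ?_ ?_).trans (hh.2 x y s t hs ht hst)) ?_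
  · exact Real.rpow_le_rpow (n x) (min_le_left _ _) hs.le
  · exact Real.rpow_le_rpow (n y) (min_le_left _ _) ht.le
  · exact Real.rpow_nonneg (n y) _
  · exact Real.rpow_nonneg (hh.1 x) _
  · have := hh.2 (-x) (-y) s t hs ht hst
    rw [show -(s * x + t * y) = s * -x + t * -y by ring]
    refine (mul_le_mul ?_ ?_ ?_ ?_).trans this
    · exact Real.rpow_le_rpow (n x) (min_le_right _ _) hs.le
    · exact Real.rpow_le_rpow (n y) (min_le_right _ _) ht.le
    · exact Real.rpow_nonneg (n y) _
    · exact Real.rpow_nonneg (hh.1 _) _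

theorem exists_convex_combination {x y z : ℝ} (h1 : x < y) (h2 : y < z) :
    ∃ s t : ℝ, 0 < s ∧ 0 < t ∧ s + t = 1 ∧ y = s * x + t * z := by
  have : 0 < z - x := by linarith
  refine ⟨(z - y) / (z - x), (y - x) / (z - x), div_pos (by linarith) this,
    div_pos (by linarith) this, ?_, ?_⟩
  · field_simp
    ring
  · field_simp
    ring

/-- Superlevel sets of a log-concave function are intervals. -/
theorem IsLogConcaveFun.measurable {h : ℝ → ℝ} (hh : IsLogConcaveFun h) : Measurable h := by
  refine measurable_of_Ici fun r => OrdConnected.measurableSet ⟨fun x hx z hz y hy => ?_⟩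
  simp only [mem_preimage, mem_Ici] at hx hz ⊢
  rcases hy.1.eq_or_lt with rfl | h1
  · exact hx
  rcases hy.2.eq_or_lt with rfl | h2
  · exact hz
  rcases le_or_gt r 0 with hr | hr
  · exact hr.trans (hh.1 y)
  obtain ⟨s, t, hs, ht, hst, rfl⟩ := exists_convex_combination h1 h2
  calc r = r ^ s * r ^ t := by rw [← Real.rpow_add hr, hst, Real.rpow_one]
    _ ≤ h x ^ s * h z ^ t := by gcongr; exact Real.rpow_nonneg (hh.1 x) _
    _ ≤ _ := hh.2 x z s t hs ht hst

/-- The point x lies between -y and y, where h takes the same value. -/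
theorem IsLogConcaveFun.antitone {h : ℝ → ℝ} (hh : IsLogConcaveFun h) (he : ∀ x, h |x| = h x)
    {x y : ℝ} (hx : 0 ≤ x) (hxy : x ≤ y) : h y ≤ h x := by
  rcases hxy.eq_or_lt with rfl | hxy
  · exact le_rfl
  obtain ⟨s, t, hs, ht, hst, rfl⟩ :=
    exists_convex_combination (by linarith : -y < x) hxy
  have := hh.2 (-y) y s t hs ht hst
  have e : h (-y) = h y := by rw [← he (-y), abs_neg, he]
  rcases (hh.1 y).eq_or_lt with h0 | h0
  · rw [← h0]
    exact hh.1 _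
  · rwa [e, ← Real.rpow_add h0, hst, Real.rpow_one] at this

/-- An integrable h of mass one is not constant, so it drops below h 0 at some x₀; log-concavity
then propagates this drop into exponential decay. This gives all moments. -/
theorem IsLogConcaveFun.exists_le_exp {h : ℝ → ℝ} (hh : IsLogConcaveFun h)
    (he : ∀ x, h |x| = h x) (hi : Integrable h) (h1 : ∫ x, h x = 1) :
    ∃ C c : ℝ, 0 < c ∧ ∀ x, h x ≤ C * twoSidedExpDensity c x := by
  have hle : ∀ x, h x ≤ h 0 := fun x => he x ▸ hh.antitone he le_rfl (abs_nonneg x)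
  have h0 : 0 < h 0 := by
    refine (hh.1 0).lt_of_ne' fun hz => ?_
    have : ∀ x, h x = 0 := fun x => le_antisymm (hz ▸ hle x) (hh.1 x)
    simp [this] at h1
  obtain ⟨x₀, hx₀, hlt⟩ : ∃ x₀, 0 < x₀ ∧ h x₀ < h 0 := by
    by_contra! hn
    have : ∀ x, h x = h 0 := by
      intro x
      refine le_antisymm (hle x) ?_
      rcases (abs_nonneg x).eq_or_lt with hx | hx
      · rw [← he x, ← hx]
      · rw [← he x]
        exact hn _ hx
    have hc : Integrable fun _ : ℝ => h 0 := hi.congr (.of_forall this)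
    rw [integrable_const_iff] at hc
    rcases hc with hc | hc
    · exact h0.ne' hc
    · simpa using hc.measure_univ_lt_top
  obtain ⟨m, hm1, hm2⟩ := exists_between hlt
  have hm : 0 < m := (hh.1 x₀).trans_lt hm1
  -- The rate is chosen so that h 0 * exp (-(c * x)) equals m at x₀. Taking m strictly above h x₀
  -- keeps it positive even if h x₀ = 0.
  set c := Real.log (h 0 / m) / x₀ with hcdef
  have hc : 0 < c := div_pos (Real.log_pos ((one_lt_div hm).2 hm2)) hx₀
  have hcx : h 0 * Real.exp (-(c * x₀)) = m := by
    rw [hcdef, div_mul_cancel₀ _ hx₀.ne', Real.exp_neg, Real.exp_log (by positivity)]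
    field_simp
  have key : ∀ x, 0 ≤ x → h x ≤ h 0 * Real.exp (c * x₀) * Real.exp (-(c * x)) := by
    intro x hx
    rw [mul_assoc, ← Real.exp_add]
    rcases le_or_gt x x₀ with hxx | hxx
    · refine (hle x).trans (le_mul_of_one_le_right h0.le (Real.one_le_exp ?_))
      have := mul_le_mul_of_nonneg_left hxx hc.le
      linarith
    -- If h exceeded the curve at x > x₀, log-concavity between 0 and x would give h x₀ ≥ m.
    · have hb : h x ≤ h 0 * Real.exp (-(c * x)) := by
        by_contra! hn
        have hxp : 0 < x := hx₀.trans hxx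
        have ht : 0 < x₀ / x := by positivity
        have hs : 0 < 1 - x₀ / x := by
          rw [sub_pos, div_lt_one hxp]
          exact hxx
        have := hh.2 0 x (1 - x₀ / x) (x₀ / x) hs ht (by ring)
        rw [mul_zero, zero_add, div_mul_cancel₀ _ hxp.ne'] at this
        have h2 : h 0 ^ (1 - x₀ / x) * (h 0 * Real.exp (-(c * x))) ^ (x₀ / x) = m := by
          rw [Real.mul_rpow h0.le (Real.exp_pos _).le, ← mul_assoc, ← Real.rpow_add h0,
            sub_add_cancel, Real.rpow_one, ← Real.exp_mul, ← hcx]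
          congr 2
          field_simp
        have h3 : h 0 ^ (1 - x₀ / x) * (h 0 * Real.exp (-(c * x))) ^ (x₀ / x)
            ≤ h 0 ^ (1 - x₀ / x) * h x ^ (x₀ / x) := by
          gcongr
        linarith
      refine hb.trans (mul_le_mul_of_nonneg_left (Real.exp_le_exp.2 ?_) h0.le)
      have := mul_pos hc hx₀
      linarith
  refine ⟨h 0 * Real.exp (c * x₀) * (2 / c), c, hc, fun x => ?_⟩
  rw [← he]
  refine (key _ (abs_nonneg x)).trans_eq ?_
  rw [twoSidedExpDensity]
  field_simp

theorem IsLogConcaveFun.integrable_abs_rpow_mul {h : ℝ → ℝ} (hh : IsLogConcaveFun h)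
    (he : ∀ x, h |x| = h x) (hi : Integrable h) (h1 : ∫ x, h x = 1) {q : ℝ} (hq : 0 ≤ q) :
    Integrable fun x => |x| ^ q * h x := by
  obtain ⟨C, c, hc, hb⟩ := hh.exists_le_exp he hi h1
  have hint := ((hasAbsMoment_plateauDensity hq (by simp : (1 : ℝ) ∈ Icc (0 : ℝ) 1)).dilate
    (inv_pos.2 hc)).1
  rw [← twoSidedExpDensity_eq_dilate hc] at hint
  refine (hint.const_mul C).mono' ?_ (.of_forall fun x => ?_)
  · have := hh.measurable
    exact Measurable.aestronglyMeasurable (by fun_prop)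
  · rw [Real.norm_of_nonneg (mul_nonneg (by positivity) (hh.1 x))]
    calc |x| ^ q * h x ≤ |x| ^ q * (C * twoSidedExpDensity c x) := by gcongr; exact hb x
      _ = _ := by ring

/-- Khinchin-type bounds for the moments of an even log-concave density. -/
theorem IsLogConcaveFun.moment_bounds {p a m : ℝ} (hp : 2 < p) (ha : 0 < a) {h : ℝ → ℝ}
    (hh : IsLogConcaveFun h) (he : ∀ x, h |x| = h x) (h0 : HasAbsMoment 0 1 h)
    (h2 : HasAbsMoment 2 (a ^ 2) h) (hm : HasAbsMoment p m h) :
    a ^ p * plateauRatio p 0 ≤ m ∧ m ≤ a ^ p * plateauRatio p 1 := by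
  constructor
  · have hs : (0 : ℝ) ∈ Icc (0 : ℝ) 1 := by simp
    obtain ⟨l, hl, g2, gp⟩ := exists_dilate_hasAbsMoment ha (plateauMoment_pos (by norm_num) hs)
      (hasAbsMoment_plateauDensity (by norm_num) hs)
      (hasAbsMoment_plateauDensity (by linarith : 0 ≤ p) hs)
    refine And.left <| absMoment_le_of_ordConnected hp he (dilate_plateauDensity_even l 0) h0
      (hasAbsMoment_zero_dilate_plateauDensity hl hs) h2 g2 hm gp ?_
    -- Where the uniform density exceeds h ≥ 0 it is a positive constant, and h is decreasing, so h
    -- stays below it up to the cutoff l.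
    refine ⟨fun x hx z hz y hy => ⟨hx.1.trans_le hy.1, ?_⟩⟩
    have hd : ∀ x : ℝ, dilate l (plateauDensity 0) x = if |x| ≤ l then l⁻¹ * (1 / 2) else 0 := by
      intro x
      simp only [dilate, plateauDensity, if_true, abs_inv_mul_le_one_iff hl]
      split_ifs <;> simp
    have hzl : z ≤ l := by
      by_contra hn
      have := hz.2
      rw [hd, abs_of_pos hz.1, if_neg hn] at this
      exact absurd this (not_lt.2 (hh.1 z))
    have hx2 := hx.2
    rw [hd, abs_of_pos hx.1, if_pos ((hy.1.trans hy.2).trans hzl)] at hx2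
    rw [hd, abs_of_pos (hx.1.trans_le hy.1), if_pos (hy.2.trans hzl)]
    exact (hh.antitone he hx.1.le hy.1).trans_lt hx2
  · have hs : (1 : ℝ) ∈ Icc (0 : ℝ) 1 := by simp
    obtain ⟨l, hl, g2, gp⟩ := exists_dilate_hasAbsMoment ha (plateauMoment_pos (by norm_num) hs)
      (hasAbsMoment_plateauDensity (by norm_num) hs)
      (hasAbsMoment_plateauDensity (by linarith : 0 ≤ p) hs)
    refine And.left <| absMoment_le_of_ordConnected hp (dilate_plateauDensity_even l 1) he
      (hasAbsMoment_zero_dilate_plateauDensity hl hs) h0 g2 h2 gp hm ?_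
    have hd : ∀ x : ℝ, 0 < x →
        dilate l (plateauDensity 1) x = l⁻¹ * (1 / 2) * Real.exp (-(l⁻¹ * x)) := by
      intro x hx
      rw [dilate, plateauDensity, if_neg one_ne_zero, max_inv_mul_sub hl, sub_self, mul_zero,
        sub_zero, max_eq_left (abs_nonneg x), abs_of_pos hx]
      ring_nf
    -- On the positive axis the exponential is log-affine, so the points where a log-concave h
    -- exceeds it form an interval.
    refine ⟨fun x hx z hz y hy => ?_⟩
    rcases hy.1.eq_or_lt with rfl | hxy
    · exact hx
    rcases hy.2.eq_or_lt with rfl | hyz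
    · exact hz
    refine ⟨hx.1.trans hxy, ?_⟩
    obtain ⟨hx1, hx2⟩ := hx
    obtain ⟨hz1, hz2⟩ := hz
    rw [hd _ (hx1.trans hxy)]
    rw [hd _ hx1] at hx2
    rw [hd _ hz1] at hz2
    obtain ⟨s, t, hs, ht, hst, rfl⟩ := exists_convex_combination hxy hyz
    set A := l⁻¹ * (1 / 2) with hA
    have hA0 : 0 < A := by positivity
    calc A * Real.exp (-(l⁻¹ * (s * x + t * z)))
        = (A * Real.exp (-(l⁻¹ * x))) ^ s * (A * Real.exp (-(l⁻¹ * z))) ^ t := by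
          rw [Real.mul_rpow hA0.le (Real.exp_pos _).le, Real.mul_rpow hA0.le (Real.exp_pos _).le,
            mul_mul_mul_comm, ← Real.rpow_add hA0, hst, Real.rpow_one, ← Real.exp_mul,
            ← Real.exp_mul, ← Real.exp_add]
          ring_nf
      _ < h x ^ s * h z ^ t :=
          mul_lt_mul'' (Real.rpow_lt_rpow (by positivity) hx2 hs)
            (Real.rpow_lt_rpow (by positivity) hz2 ht) (by positivity) (by positivity)
      _ ≤ _ := hh.2 x z s t hs ht hst

/-! ### Symmetric log-concave random variables. -/

theorem map_neg_withDensity {f : ℝ → ℝ≥0∞} (hf : Measurable f) :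
    (volume.withDensity f).map (fun x => -x) = volume.withDensity fun x => f (-x) := by
  ext A hA
  rw [Measure.map_apply measurable_neg hA, withDensity_apply _ (measurable_neg hA),
    withDensity_apply _ hA]
  have := (Measure.measurePreserving_neg (volume : Measure ℝ)).setLIntegral_comp_preimage hA
    (f := fun x => f (-x)) (hf.comp measurable_neg)
  rw [← this]
  simp

/-- A symmetric log-concave random variable has an even log-concave density. -/
theorem exists_even_density {Ω : Type*} [MeasurableSpace Ω] {P : Measure Ω}
    [IsProbabilityMeasure P] {X : Ω → ℝ} (hs : IsSymmetricVar X P) (hl : IsLogConcaveVar X P) :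
    ∃ h : ℝ → ℝ, IsLogConcaveFun h ∧ (∀ x, h |x| = h x) ∧
      P.map X = volume.withDensity fun x => ENNReal.ofReal (h x) := by
  obtain ⟨hX, φ, hφ, hmap⟩ := hl
  obtain ⟨h, hh, hφh⟩ := hφ.exists_isLogConcaveFun
  simp_rw [hφh] at hmap
  have hmeas : Measurable fun x => ENNReal.ofReal (h x) := hh.measurable.ennreal_ofReal
  have hsym : volume.withDensity (fun x => ENNReal.ofReal (h x))
      = volume.withDensity fun x => ENNReal.ofReal (h (-x)) := by
    rw [← map_neg_withDensity hmeas, ← hmap,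
      AEMeasurable.map_map_of_aemeasurable measurable_neg.aemeasurable hX]
    exact hs.map_eq.symm
  -- Finite mass is what allows equality of the two measures to be turned into a.e. equality of
  -- their densities.
  have hfin : ∫⁻ x, ENNReal.ofReal (h x) ≠ ∞ := by
    have := congrArg (fun μ => μ univ) hmap
    simp only [withDensity_apply _ MeasurableSet.univ, Measure.restrict_univ] at this
    rw [← this]
    have := Measure.isProbabilityMeasure_map (μ := P) hX
    simp
  have hae := (withDensity_eq_iff hmeas.aemeasurable
    (hmeas.comp measurable_neg).aemeasurable hfin).1 hsym
  refine ⟨fun x => min (h x) (h (-x)), hh.min_comp_neg, fun x => ?_, ?_⟩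
  · rcases abs_choice x with hx | hx <;> simp [hx, min_comm]
  · rw [hmap]
    refine withDensity_congr_ae ?_
    filter_upwards [hae] with x hx
    have : h x = h (-x) := (ENNReal.ofReal_eq_ofReal_iff (hh.1 _) (hh.1 _)).1 hx
    simp [← this]

theorem integrable_and_integral_of_map_eq {Ω : Type*} [MeasurableSpace Ω] {P : Measure Ω}
    {X : Ω → ℝ} (hX : AEMeasurable X P) {h : ℝ → ℝ} (hm : Measurable h) (hn : ∀ x, 0 ≤ h x)
    (hmap : P.map X = volume.withDensity fun x => ENNReal.ofReal (h x)) {F : ℝ → ℝ}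
    (hF : Measurable F) :
    (Integrable (fun ω => F (X ω)) P ↔ Integrable fun x => F x * h x) ∧
      ∫ ω, F (X ω) ∂P = ∫ x, F x * h x := by
  have hlt : ∀ᵐ x : ℝ, ENNReal.ofReal (h x) < ∞ := .of_forall fun _ => ENNReal.ofReal_lt_top
  constructor
  · have := integrable_map_measure (f := X) (g := F) hF.aestronglyMeasurable hX
    rw [← Function.comp_def, ← this, hmap,
      integrable_withDensity_iff hm.ennreal_ofReal hlt]
    simp only [ENNReal.toReal_ofReal (hn _)]
  · rw [← integral_map hX hF.aestronglyMeasurable, hmap,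
      integral_withDensity_eq_integral_toReal_smul hm.ennreal_ofReal hlt]
    simp only [ENNReal.toReal_ofReal (hn _), smul_eq_mul, mul_comm]

theorem moments_of_symmetric_logConcave {p : ℝ} (hp : 2 < p) {Ω : Type*} [MeasurableSpace Ω]
    {P : Measure Ω} [IsProbabilityMeasure P] {X : Ω → ℝ} (hs : IsSymmetricVar X P)
    (hl : IsLogConcaveVar X P) :
    Integrable (fun ω => X ω ^ 2) P ∧ Integrable (fun ω => |X ω| ^ p) P ∧
      ∃ a b : ℝ, 0 < a ∧ 0 < b ∧ ∫ ω, X ω ^ 2 ∂P = a ^ 2 ∧ ∫ ω, |X ω| ^ p ∂P = b ^ p ∧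
        Feasible p a b := by
  obtain ⟨h, hh, he, hmap⟩ := exists_even_density hs hl
  have hp0 : 0 < p := by linarith
  have tr := fun {F : ℝ → ℝ} (hF : Measurable F) =>
    integrable_and_integral_of_map_eq hl.1 hh.measurable hh.1 hmap hF
  have t1 := tr (F := fun _ => 1) measurable_const
  have t2 := tr (F := fun x => |x| ^ (2 : ℝ)) (by fun_prop)
  have tp := tr (F := fun x => |x| ^ p) (by fun_prop)
  simp only [one_mul, integrable_const, true_iff] at t1
  have h1 : ∫ x, h x = 1 := by simpa using t1.2.symm
  have hint : ∀ {q : ℝ}, 0 ≤ q → Integrable fun x => |x| ^ q * h x :=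
    hh.integrable_abs_rpow_mul he t1.1 h1
  have hpos : ∀ {q : ℝ}, 0 < q → 0 < ∫ x, |x| ^ q * h x := by
    intro q hq
    have hnn : ∀ x, 0 ≤ |x| ^ q * h x := fun x => mul_nonneg (by positivity) (hh.1 x)
    refine (integral_nonneg hnn).lt_of_ne' fun hz => ?_
    have := ae_eq_zero_of_integral_mul_eq_zero (D := fun x => |x| ^ q) ?_ (.of_forall hnn)
      (hint hq.le) hz
    · rw [integral_eq_zero_of_ae this] at h1
      exact zero_ne_one h1
    · filter_upwards [ae_abs_ne 0] with x hx
      exact (Real.rpow_pos_of_pos (lt_of_le_of_ne (abs_nonneg x) hx.symm) q).ne'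
  have p2 := hpos (q := 2) (by norm_num)
  have pp := hpos hp0
  have ha : 0 < √(∫ x, |x| ^ (2 : ℝ) * h x) := Real.sqrt_pos.2 p2
  have hb : 0 < (∫ x, |x| ^ p * h x) ^ p⁻¹ := Real.rpow_pos_of_pos pp _
  have ha2 : (√(∫ x, |x| ^ (2 : ℝ) * h x)) ^ 2 = ∫ x, |x| ^ (2 : ℝ) * h x := Real.sq_sqrt p2.le
  have hbp : ((∫ x, |x| ^ p * h x) ^ p⁻¹) ^ p = ∫ x, |x| ^ p * h x :=
    Real.rpow_inv_rpow pp.le hp0.ne'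
  have bounds := hh.moment_bounds hp ha he ⟨by simpa using t1.1, by simpa using h1⟩
    ⟨hint (by norm_num), ha2.symm⟩ ⟨hint hp0.le, rfl⟩
  have hi2 := t2.1.2 (hint (by norm_num))
  refine ⟨by simpa using hi2, tp.1.2 (hint hp0.le), _, _, ha, hb, ?_, ?_, ?_⟩
  · rw [ha2, ← t2.2]
    simp
  · rw [hbp, ← tp.2]
  · rw [feasible_iff hp ha hb, Real.div_rpow hb.le ha.le, hbp, le_div_iff₀' (by positivity),
      div_le_iff₀' (by positivity)]
    exact bounds

theorem lemma5 (p : ℝ) (hp : 2 < p) :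
    (∀ a b : ℝ, 0 < a → 0 < b → Feasible p a b →
      (∃! f : ℝ → ℝ, f ∈ familyMinus ∧ HasMoments p a b f) ∧
      (∃! f : ℝ → ℝ, f ∈ familyPlus ∧ HasMoments p a b f)) ∧
    (∀ (Ω : Type*) [MeasurableSpace Ω] (P : Measure Ω) [IsProbabilityMeasure P] (X : Ω → ℝ),
      IsSymmetricVar X P → IsLogConcaveVar X P →
      Integrable (fun ω => X ω ^ 2) P ∧ Integrable (fun ω => |X ω| ^ p) P ∧
      ∃ a b : ℝ, 0 < a ∧ 0 < b ∧ ∫ ω, X ω ^ 2 ∂P = a ^ 2 ∧ ∫ ω, |X ω| ^ p ∂P = b ^ p ∧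
        Feasible p a b) := by
  refine ⟨fun a b ha hb h => ⟨?_, ?_⟩, fun Ω _ P _ X hs hl =>
    moments_of_symmetric_logConcave hp hs hl⟩
  · obtain ⟨f, hf, hfm⟩ := exists_mem_familyMinus hp ha hb h
    exact ⟨f, ⟨hf, hfm⟩, fun g hg => familyMinus_unique hp hg.1 hf hg.2 hfm⟩
  · obtain ⟨f, hf, hfm⟩ := exists_mem_familyPlus hp ha hb h
    exact ⟨f, ⟨hf, hfm⟩, fun g hg => familyPlus_unique hp hg.1 hf hg.2 hfm⟩
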